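/- All manifolds (and Lie groups) are real, smooth, finite-dimensional, Hausdorff, second countable and without boundary. Let $\pi:P\to M$ be a smooth principal bundle whose structure group is a Lie group $G$ (acting on $P$ from the right) with semisimple Lie algebra $\mathfrak g=\mathrm{Lie}(G)$, i.e. $\mathfrak g$ has no nonzero solvable ideal. Let $\mathcal A=\mathfrak X_G(P)$ be the Lie algebra of $G$-invariant smooth vector fields on $P$ (the smooth sections of the Atiyah algebroid $TP/G$), and let $\mathcal K=\{k\in\mathcal A : T_u\pi(k_u)=0 \text{ for all } u\in P\}$ be the kernel of the Atiyah sequence $0\to\mathcal K\to\mathcal A\xrightarrow{\pi_*}\mathfrak X(M)\to 0$; its elements are the smooth sections of the Lie algebra bundle $K=P\times_G\mathfrak g$. For $u\in P$ and $h\in\mathfrak g$ let $X_u^h\in T_uP$ be the fundamental vector, i.e. the derivative at $1\in G$ of $g\mapsto u\cdot g$ in the direction $h$. Choose for every $m\in M$ a point $\sigma(m)\in P$ with $\pi(\sigma(m))=m$ (no continuity is required) and identify the fibre $K_m$ with $\mathfrak g$ by $[X_{\sigma(m)}^h]\leftrightarrow h$. For $m\in M$ and a Lie ideal $\mathfrak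 g_0$ of $\mathfrak g$ put $$\mathcal K(m,\mathfrak g_0)=\{k\in\mathcal K : k_m\in\mathfrak g_0\}=\{k\in\mathcal K : k_{\sigma(m)}=X_{\sigma(m)}^h\text{ for some }h\in\mathfrak g_0\}.$$ Call a Lie ideal of $\mathcal K$ maximal finite-codimensional if it is maximal among the proper Lie ideals of $\mathcal K$ that have finite codimension. Then, for every choice of $\sigma$, the maximal finite-codimensional Lie ideals of $\mathcal K$ are exactly the subspaces $\mathcal K(m,\mathfrak g_0)$, where $m\in M$ and $\mathfrak g_0$ is a maximal (proper) Lie ideal of $\mathfrak g$. -/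

import Mathlib

open scoped Manifold ContDiff RightActions Topology
open VectorField

namespace Atiyah

noncomputable section

/-- Every `C^∞` manifold (or Lie group) over `ℝ` has the finite smoothness that the Lie bracket
of vector fields asks for. -/
instance leInfty_minSmoothness (n : WithTop ℕ∞) [h : ENat.LEInfty n] :
    ENat.LEInfty (minSmoothness ℝ n) :=
  ⟨by simpa using h.out⟩

section VectorFields

variable {E : Type*} [NormedAddCommGroup E] [NormedSpace ℝ E]
  {H : Type*} [TopologicalSpace H] (I : ModelWithCorners ℝ E H)
  (P : Type*) [TopologicalSpace P] [ChartedSpace H P] [IsManifold I ∞ P]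

/-- The real vector space `𝔛(P)` of smooth vector fields on the manifold `P`. -/
abbrev SmoothVectorField : Type _ :=
  ContMDiffSection I E ∞ (TangentSpace I : P → Type _)

variable {I P}

theorem SmoothVectorField.mdifferentiableAt (X : SmoothVectorField I P) (x : P) :
    MDifferentiableAt I I.tangent (fun y ↦ (X y : TangentBundle I P)) x :=
  (X.contMDiff x).mdifferentiableAt (by simp)

variable [CompleteSpace E]

/-- The Lie bracket of vector fields. -/
instance : Bracket (SmoothVectorField I P) (SmoothVectorField I P) where
  bracket X Y :=
    { toFun := mlieBracket I X Y
      contMDiff_toFun := by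
        have : IsManifold I (((⊤ : ℕ∞) : WithTop ℕ∞) + 1) P := by
          simpa using (inferInstance : IsManifold I ∞ P)
        exact ContDiff.mlieBracket_vectorField (m := ⊤) (n := ⊤) X.contMDiff Y.contMDiff
          (by simp) }

theorem SmoothVectorField.lie_apply (X Y : SmoothVectorField I P) (x : P) :
    ⁅X, Y⁆ x = mlieBracket I X Y x := rfl

theorem SmoothVectorField.coe_lie (X Y : SmoothVectorField I P) :
    (⇑⁅X, Y⁆ : ∀ x, TangentSpace I x) = mlieBracket I X Y := rfl

instance : LieRing (SmoothVectorField I P) where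
  add_lie X Y Z := by
    ext x
    exact mlieBracket_add_left (X.mdifferentiableAt x) (Y.mdifferentiableAt x)
  lie_add X Y Z := by
    ext x
    exact mlieBracket_add_right (Y.mdifferentiableAt x) (Z.mdifferentiableAt x)
  lie_self X := by
    ext x
    simp [SmoothVectorField.lie_apply]
  leibniz_lie X Y Z := by
    ext x
    exact leibniz_identity_mlieBracket_apply
      ((X.contMDiff x).of_le ENat.LEInfty.out) ((Y.contMDiff x).of_le ENat.LEInfty.out)
      ((Z.contMDiff x).of_le ENat.LEInfty.out)

instance : LieAlgebra ℝ (SmoothVectorField I P) where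
  lie_smul c X Y := by
    ext x
    exact mlieBracket_const_smul_right (Y.mdifferentiableAt x)

/-- If a function is constant along two vector fields near a point, it is constant along their
bracket at that point. -/
theorem mvfderiv_lie_eq_zero (X Y : SmoothVectorField I P) (f : P → ℝ) (x : P)
    (hf : ∀ᶠ y in 𝓝 x, ContMDiffAt I 𝓘(ℝ, ℝ) ∞ f y)
    (hX : ∀ᶠ y in 𝓝 x, mfderiv I 𝓘(ℝ, ℝ) f y (X y) = 0)
    (hY : ∀ᶠ y in 𝓝 x, mfderiv I 𝓘(ℝ, ℝ) f y (Y y) = 0) :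
    mfderiv I 𝓘(ℝ, ℝ) f x (⁅X, Y⁆ x) = 0 := by
  have key : ∀ U : SmoothVectorField I P,
      (mvfderiv I f x (⁅X, Y⁆ x)) • U x = 0 := by
    intro U
    have hZ : ∀ Z : SmoothVectorField I P,
        (∀ᶠ y in 𝓝 x, mfderiv I 𝓘(ℝ, ℝ) f y (Z y) = 0) → ∀ W : SmoothVectorField I P,
        mlieBracket I Z (f • (W : ∀ y, TangentSpace I y)) =ᶠ[𝓝 x]
          f • (⇑(⁅Z, W⁆ : SmoothVectorField I P) : ∀ y, TangentSpace I y) := by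
      intro Z hZ W
      filter_upwards [hf, hZ] with y hfy hy
      rw [mlieBracket_smul_right (hfy.mdifferentiableAt (by simp)) (W.mdifferentiableAt y)]
      have : (mvfderiv I f y) (Z y) = 0 := hy
      rw [this, zero_smul, zero_add]
      rfl
    have hfx : ContMDiffAt I 𝓘(ℝ, ℝ) ∞ f x := hf.self_of_nhds
    have hfU : ContMDiffAt I I.tangent (minSmoothness ℝ 2)
        (fun y ↦ ((f • (U : ∀ y, TangentSpace I y)) y : TangentBundle I P)) x :=
      ((hfx.smul_section (U.contMDiff x))).of_le ENat.LEInfty.out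
    have J := leibniz_identity_mlieBracket_apply (I := I)
      ((X.contMDiff x).of_le ENat.LEInfty.out) ((Y.contMDiff x).of_le ENat.LEInfty.out) hfU
    have e1 : mlieBracket I X (mlieBracket I Y (f • (U : ∀ y, TangentSpace I y))) x =
        f x • ⁅X, ⁅Y, U⁆⁆ x := by
      rw [(Filter.EventuallyEq.rfl).mlieBracket_vectorField_eq (hZ Y hY U)]
      exact (hZ X hX ⁅Y, U⁆).self_of_nhds
    have e2 : mlieBracket I Y (mlieBracket I X (f • (U : ∀ y, TangentSpace I y))) x =
        f x • ⁅Y, ⁅X, U⁆⁆ x := by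
      rw [(Filter.EventuallyEq.rfl).mlieBracket_vectorField_eq (hZ X hX U)]
      exact (hZ Y hY ⁅X, U⁆).self_of_nhds
    have e3 : mlieBracket I (mlieBracket I X Y) (f • (U : ∀ y, TangentSpace I y)) x =
        (mvfderiv I f x (⁅X, Y⁆ x)) • U x + f x • ⁅⁅X, Y⁆, U⁆ x :=
      mlieBracket_smul_right (hfx.mdifferentiableAt (by simp)) (U.mdifferentiableAt x)
    have e4 : (⁅X, ⁅Y, U⁆⁆ : SmoothVectorField I P) x
        = ⁅⁅X, Y⁆, U⁆ x + ⁅Y, ⁅X, U⁆⁆ x := by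
      rw [leibniz_lie X Y U]; rfl
    rw [e1, e2, e3, e4, smul_add] at J
    have := add_right_cancel J
    exact (right_eq_add.mp this)
  by_cases h1 : X x = 0
  · by_cases h2 : Y x = 0
    · have : (⁅X, Y⁆ : SmoothVectorField I P) x = 0 := by
        rw [SmoothVectorField.lie_apply, ← mlieBracketWithin_univ]
        exact mlieBracketWithin_eq_zero_of_eq_zero h1 h2
      rw [this, map_zero]
    · exact (smul_eq_zero.mp (key Y)).resolve_right h2
  · exact (smul_eq_zero.mp (key X)).resolve_right h1

end VectorFields

variable {EM : Type*} [NormedAddCommGroup EM] [NormedSpace ℝ EM]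
  {HM : Type*} [TopologicalSpace HM] (IM : ModelWithCorners ℝ EM HM)
  {EG : Type*} [NormedAddCommGroup EG] [NormedSpace ℝ EG]
  {HG : Type*} [TopologicalSpace HG] (IG : ModelWithCorners ℝ EG HG)
  {EP : Type*} [NormedAddCommGroup EP] [NormedSpace ℝ EP]
  {HP : Type*} [TopologicalSpace HP] (IP : ModelWithCorners ℝ EP HP)
  {M : Type*} [TopologicalSpace M] [ChartedSpace HM M]
  {G : Type*} [TopologicalSpace G] [ChartedSpace HG G] [Group G]
  {P : Type*} [TopologicalSpace P] [ChartedSpace HP P] [MulAction Gᵐᵒᵖ P]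

variable (G) in
/-- `π : P → M` is a smooth principal bundle with structure group `G`, for the right action
`(u, g) ↦ u <• g` of `G` on `P`: the action and the projection are smooth, and around every point
of `M` there is a smooth local trivialization `π ⁻¹ U ≃ U × G` over `U` that intertwines the action
with right multiplication on `G`. -/
structure IsPrincipalBundle (π : P → M) : Prop where
  contMDiff_proj : ContMDiff IP IM ∞ π
  contMDiff_act : ContMDiff (IP.prod IG) IP ∞ (fun p : P × G ↦ p.1 <• p.2)
  exists_trivialization : ∀ m : M, ∃ (U : Set M) (e : OpenPartialHomeomorph P (M × G)),
    IsOpen U ∧ m ∈ U ∧ e.source = π ⁻¹' U ∧ e.target = U ×ˢ Set.univ ∧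
    ContMDiffOn IP (IM.prod IG) ∞ e e.source ∧
    ContMDiffOn (IM.prod IG) IP ∞ e.symm e.target ∧
    (∀ u ∈ e.source, (e u).1 = π u) ∧
    ∀ u ∈ e.source, ∀ g : G, u <• g ∈ e.source ∧ e (u <• g) = ((e u).1, (e u).2 * g)

/-- The fundamental vectors `X_u^h`, as a linear map in `h`: the derivative at `1` of the orbit map
`g ↦ u <• g`, from the Lie algebra of `G` to `T_u P`. -/
def fundamentalMap (u : P) :
    GroupLieAlgebra IG G →ₗ[ℝ] TangentSpace IP u where
  toFun h := (mfderiv IG IP (fun g : G ↦ u <• g) 1 h : EP)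
  map_add' h h' := map_add (mfderiv IG IP (fun g : G ↦ u <• g) 1) h h'
  map_smul' c h := map_smul (mfderiv IG IP (fun g : G ↦ u <• g) 1) c h

namespace IsPrincipalBundle

variable {IM IG IP} {π : P → M}

theorem contMDiff_right (hP : IsPrincipalBundle IM IG IP G π)
    (g : G) : ContMDiff IP IP ∞ (fun u : P ↦ u <• g) :=
  hP.contMDiff_act.comp (contMDiff_id.prodMk contMDiff_const)

/-- The diffeomorphism `r_g : u ↦ u <• g` of `P`. -/
def rightDiffeo (hP : IsPrincipalBundle IM IG IP G π) (g : G) :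
    P ≃ₘ^∞⟮IP, IP⟯ P where
  toFun u := u <• g
  invFun u := u <• g⁻¹
  left_inv u := by simp
  right_inv u := by simp
  contMDiff_toFun := hP.contMDiff_right g
  contMDiff_invFun := hP.contMDiff_right g⁻¹

theorem isInvariant_iff (hP : IsPrincipalBundle IM IG IP G π)
    (g : G) (X : ∀ u : P, TangentSpace IP u) :
    (∀ u, mfderiv IP IP (fun v : P ↦ v <• g) u (X u) = X (u <• g)) ↔
      mpullback IP IP (fun v : P ↦ v <• g) X = X := by
  have hinv : ∀ u : P, (mfderiv IP IP (fun v : P ↦ v <• g) u).IsInvertible := fun u ↦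
    ⟨(hP.rightDiffeo g).mfderivToContinuousLinearEquiv (by simp) u, rfl⟩
  constructor
  · intro h
    funext u
    rw [mpullback_apply, ← h u]
    exact (hinv u).inverse_apply_eq.mpr rfl
  · intro h u
    have := congrFun h u
    rw [mpullback_apply] at this
    exact ((hinv u).inverse_apply_eq.mp this).symm

variable [IsManifold IP ∞ P] [CompleteSpace EP]

/-- The Lie algebra `𝒜 = 𝔛_G(P)` of `G`-invariant smooth vector fields on `P`, that is, of smooth
sections of the Atiyah algebroid `TP/G`. -/
def atiyahAlgebra (hP : IsPrincipalBundle IM IG IP G π) :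
    LieSubalgebra ℝ (SmoothVectorField IP P) where
  carrier := {X | ∀ (g : G) (u : P), mfderiv IP IP (fun v : P ↦ v <• g) u (X u) = X (u <• g)}
  add_mem' {X Y} hX hY g u := by
    have := map_add (mfderiv IP IP (fun v : P ↦ v <• g) u) (X u) (Y u)
    rw [hX g u, hY g u] at this
    exact this
  zero_mem' g u := map_zero (mfderiv IP IP (fun v : P ↦ v <• g) u)
  smul_mem' c X hX g u := by
    have := map_smul (mfderiv IP IP (fun v : P ↦ v <• g) u) c (X u)
    rw [hX g u] at this
    exact this
  lie_mem' {X Y} hX hY g := by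
    refine (hP.isInvariant_iff g _).mpr ?_
    funext u
    rw [SmoothVectorField.coe_lie, mpullback_mlieBracket (n := ∞) (X.mdifferentiableAt _)
      (Y.mdifferentiableAt _) (hP.contMDiff_right g u) ENat.LEInfty.out,
      (hP.isInvariant_iff g X).mp (hX g), (hP.isInvariant_iff g Y).mp (hY g)]

variable [IsManifold IM ∞ M]

theorem mfderiv_proj_lie (hP : IsPrincipalBundle IM IG IP G π)
    (X Y : SmoothVectorField IP P)
    (hX : ∀ u, mfderiv IP IM π u (X u) = 0) (hY : ∀ u, mfderiv IP IM π u (Y u) = 0) (u : P) :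
    mfderiv IP IM π u (⁅X, Y⁆ u) = 0 := by
  have hπ : ∀ v, MDifferentiableAt IP IM π v := fun v ↦
    (hP.contMDiff_proj v).mdifferentiableAt (by simp)
  set φ := extChartAt IM (π u) with hφ
  have hsrc : ∀ᶠ v in 𝓝 u, π v ∈ (chartAt HM (π u)).source :=
    hP.contMDiff_proj.continuous.continuousAt.eventually (chart_source_mem_nhds HM (π u))
  have hφs : ∀ y ∈ (chartAt HM (π u)).source, ContMDiffAt IM 𝓘(ℝ, EM) ∞ φ y :=
    fun y hy ↦ contMDiffAt_extChartAt' hy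
  have hd : ∀ (ℓ : EM →L[ℝ] ℝ) (v : P), π v ∈ (chartAt HM (π u)).source →
      ∀ w : TangentSpace IP v, mfderiv IP 𝓘(ℝ, ℝ) (fun v ↦ ℓ (φ (π v))) v w =
        ℓ (mfderiv IM 𝓘(ℝ, EM) φ (π v) (mfderiv IP IM π v w)) := by
    intro ℓ v hv w
    have h1 := (hφs _ hv).mdifferentiableAt (by simp)
    have h2 : HasMFDerivAt IP 𝓘(ℝ, ℝ) (fun v ↦ ℓ (φ (π v))) v _ :=
      (ℓ.hasMFDerivAt (x := φ (π v))).comp v (h1.hasMFDerivAt.comp v (hπ v).hasMFDerivAt)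
    rw [h2.mfderiv]
    rfl
  have hinj : Function.Injective (mfderiv IM 𝓘(ℝ, EM) φ (π u)) :=
    (isInvertible_mfderiv_extChartAt (mem_extChartAt_source (π u))).injective
  apply hinj
  rw [map_zero]
  by_contra hne
  have hsep : ∀ z : EM, z ≠ 0 → ∃ ℓ : EM →L[ℝ] ℝ, ℓ z ≠ 0 := fun z hz ↦
    SeparatingDual.exists_ne_zero hz
  obtain ⟨ℓ, hℓ⟩ := hsep _ hne
  apply hℓ
  have hu : π u ∈ (chartAt HM (π u)).source := mem_chart_source HM (π u)
  refine (hd ℓ u hu _).symm.trans ?_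
  refine mvfderiv_lie_eq_zero X Y _ u ?_ ?_ ?_
  · filter_upwards [hsrc] with v hv
    exact (ℓ.contMDiff.contMDiffAt).comp v ((hφs _ hv).comp v (hP.contMDiff_proj v))
  · filter_upwards [hsrc] with v hv
    rw [hd ℓ v hv, hX v, map_zero]
    exact map_zero ℓ
  · filter_upwards [hsrc] with v hv
    rw [hd ℓ v hv, hY v, map_zero]
    exact map_zero ℓ

/-- The kernel `𝒦` of the Atiyah sequence `0 → 𝒦 → 𝒜 → 𝔛(M) → 0`. The anchor `π_*` sends an
invariant vector field `a` to the vector field on `M` with value `T_u π (a u)` at `π u`, so `𝒦`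
consists of the invariant vector fields `a` with `T_u π (a u) = 0` for all `u`. -/
def atiyahKernel (hP : IsPrincipalBundle IM IG IP G π) :
    LieSubalgebra ℝ hP.atiyahAlgebra where
  carrier := {a | ∀ u : P, mfderiv IP IM π u (a.1 u) = 0}
  add_mem' {a b} ha hb u := by
    have := map_add (mfderiv IP IM π u) (a.1 u) (b.1 u)
    rw [ha u, hb u, add_zero] at this
    exact this
  zero_mem' u := map_zero (mfderiv IP IM π u)
  smul_mem' c a ha u := by
    have := map_smul (mfderiv IP IM π u) c (a.1 u)
    rw [ha u, smul_zero] at this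
    exact this
  lie_mem' {a b} ha hb := hP.mfderiv_proj_lie a.1 b.1 ha hb

/-- The evaluation `k ↦ k u` of elements of `𝒦` at a point `u` of `P`. -/
def evalAt (hP : IsPrincipalBundle IM IG IP G π) (u : P) :
    hP.atiyahKernel →ₗ[ℝ] TangentSpace IP u where
  toFun k := k.1.1 u
  map_add' _ _ := rfl
  map_smul' _ _ := rfl

variable [LieGroup IG ∞ G] [CompleteSpace EG]

/-- The space `𝒦(m, 𝔤₀) = {k ∈ 𝒦 : k_m ∈ 𝔤₀}` for `m = π u`. The fibre at `m` of the bundle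
`K = P ×_G 𝔤` is identified with `𝔤` by means of the point `u` of `P` over `m`, the class of the
fundamental vector `X_u^h` corresponding to `h`; so `k_m ∈ 𝔤₀` means that `k u = X_u^h` for
some `h ∈ 𝔤₀`. -/
def kernelIdeal (hP : IsPrincipalBundle IM IG IP G π) (u : P)
    (g₀ : LieIdeal ℝ (GroupLieAlgebra IG G)) : Submodule ℝ hP.atiyahKernel :=
  (g₀.toSubmodule.map (fundamentalMap IG IP u)).comap (hP.evalAt u)

end IsPrincipalBundle

/-- A maximal finite-codimensional Lie ideal: it is maximal among the proper Lie ideals of finite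
codimension. -/
def IsMaximalFiniteCodimensional {L : Type*} [LieRing L] [LieAlgebra ℝ L]
    (J : LieIdeal ℝ L) : Prop :=
  Maximal (fun J' : LieIdeal ℝ L ↦ J' ≠ ⊤ ∧ FiniteDimensional ℝ (L ⧸ J'.toSubmodule)) J

end

end Atiyah

/-!
Evaluation at `σ m` identifies the fibre of `K` at `m` with `𝔤`. Since an element of `𝒦` is related
to a left-invariant vector field on `G` by `g ↦ u <• g⁻¹`, evaluation is, up to a sign, a Lie
algebra morphism, and `𝒦` becomes the `C^∞(M)`-Lie algebra of sections of a bundle with perfect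
fibres. Finitely many sections generate all fibres: on a compact set, a dimension count reduces the
number of generators to `dim M + dim 𝔤 + 1`, and the layers of a proper function on `M` are glued
with two colours. Hence `𝒦 = ⁅𝒦, 𝒦⁆`.

A maximal ideal `J` of finite codimension is then its own normalizer, so that the identity
`⁅f • k, x⁆ = ⁅k, f • x⁆`
makes it a `C^∞(M)`-submodule. The annihilator of `𝒦 / J` is a prime ideal of finite codimension in
`C^∞(M)`, hence the ideal of the functions that vanish at some point `m`. The sections vanishing at
`m` are combinations of the generators with coefficients vanishing at `m`, so they lie in `J`, and
`J` is the preimage of a maximal ideal of `𝔤` under the evaluation at `m`.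
-/

namespace Atiyah

section LieIdeals

variable {R : Type*} [CommRing R] {L L' : Type*} [LieRing L] [LieAlgebra R L]
  [LieRing L'] [LieAlgebra R L'] {f : L →ₗ⁅R⁆ L'}

theorem map_comap_of_surjective (hf : Function.Surjective f) (I : LieIdeal R L') :
    LieIdeal.map f (LieIdeal.comap f I) = I := by
  rw [LieIdeal.map_comap_eq (f.isIdealMorphism_of_surjective hf),
    f.idealRange_eq_top_of_surjective hf, top_inf_eq]

theorem comap_map_of_surjective (hf : Function.Surjective f) {J : LieIdeal R L}
    (hJ : f.ker ≤ J) : LieIdeal.comap f (LieIdeal.map f J) = J := by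
  rw [LieIdeal.comap_map_eq (congrArg SetLike.coe (LieIdeal.coe_map_of_surjective hf)),
    sup_eq_left.mpr hJ]

theorem isCoatom_comap_iff (hf : Function.Surjective f) {I : LieIdeal R L'} :
    IsCoatom (LieIdeal.comap f I) ↔ IsCoatom I := by
  have gi : GaloisInsertion (LieIdeal.map f) (LieIdeal.comap f) :=
    (LieIdeal.gc_map_comap f).toGaloisInsertion fun I ↦ (map_comap_of_surjective hf I).ge
  refine ⟨gi.isCoatom_of_image, fun hI ↦ ⟨fun h ↦ hI.1 ?_, fun J hJ ↦ ?_⟩⟩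
  · exact gi.u_injective (h.trans gi.gc.u_top.symm)
  · have hker : f.ker ≤ J := (LieIdeal.comap_mono bot_le).trans hJ.le
    rw [← comap_map_of_surjective hf hker] at hJ ⊢
    rw [hI.2 _ ((lt_iff_lt_of_le_iff_le' gi.u_le_u_iff gi.u_le_u_iff).mp hJ), gi.gc.u_top]

end LieIdeals

theorem isMaximalFiniteCodimensional_iff {L : Type*} [LieRing L] [LieAlgebra ℝ L]
    {J : LieIdeal ℝ L} :
    IsMaximalFiniteCodimensional J ↔ IsCoatom J ∧ J.toSubmodule.CoFG := by
  refine ⟨fun hJ ↦ ⟨⟨hJ.prop.1, fun N hN ↦ ?_⟩, hJ.prop.2⟩, fun ⟨hJ, hfin⟩ ↦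
    ⟨⟨hJ.1, hfin⟩, fun N hN hle ↦ ((hJ.le_iff_eq hN.1).mp hle).le⟩⟩
  by_contra hN'
  exact hN.not_ge (hJ.le_of_ge ⟨hN', Submodule.CoFG.of_le hN.le hJ.prop.2⟩ hN.le)

theorem isMaximalFiniteCodimensional_comap_iff {L : Type*} [LieRing L] [LieAlgebra ℝ L]
    {𝔤 : Type*} [LieRing 𝔤] [LieAlgebra ℝ 𝔤] [FiniteDimensional ℝ 𝔤]
    {f : L →ₗ⁅ℝ⁆ 𝔤} (hf : Function.Surjective f) {g₀ : LieIdeal ℝ 𝔤} :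
    IsMaximalFiniteCodimensional (LieIdeal.comap f g₀) ↔ IsCoatom g₀ := by
  have hfin : (LieIdeal.comap f g₀).toSubmodule.CoFG :=
    Submodule.CoFG.of_le (LieIdeal.comap_mono (bot_le (a := g₀)))
      (Submodule.CoFG.ker (f : L →ₗ[ℝ] 𝔤))
  rw [isMaximalFiniteCodimensional_iff, isCoatom_comap_iff hf, and_iff_left hfin]

theorem lie_top_eq_top_of_hasTrivialRadical (R 𝔤 : Type*) [CommRing R] [LieRing 𝔤]
    [LieAlgebra R 𝔤] [ComplementedLattice (LieIdeal R 𝔤)] [LieAlgebra.HasTrivialRadical R 𝔤] :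
    ⁅(⊤ : LieIdeal R 𝔤), (⊤ : LieIdeal R 𝔤)⁆ = ⊤ := by
  obtain ⟨C, hC⟩ := exists_isCompl ⁅(⊤ : LieIdeal R 𝔤), (⊤ : LieIdeal R 𝔤)⁆
  have hC_abelian : IsLieAbelian C :=
    (LieSubmodule.lie_abelian_iff_lie_self_eq_bot C).mpr <| eq_bot_iff.mpr <|
      (le_inf (LieSubmodule.mono_lie le_top le_top) (LieSubmodule.lie_le_left C C)).trans
        hC.inf_eq_bot.le
  have hC_bot : C = ⊥ :=
    (LieAlgebra.hasTrivialRadical_iff_no_abelian_ideals R 𝔤).mp inferInstance C hC_abelian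
  simpa only [hC_bot, sup_bot_eq] using hC.sup_eq_top

theorem smul_mem_of_isCoatom {R A L : Type*} [CommRing R] [CommRing A] [LieRing L] [LieAlgebra R L]
    [LieAlgebra A L] (hL : ⁅(⊤ : LieIdeal R L), (⊤ : LieIdeal R L)⁆ = ⊤)
    {J : LieIdeal R L} (hJ : IsCoatom J) (a : A) {k : L} (hk : k ∈ J) : a • k ∈ J := by
  have hnormalizer : J.normalizer = J := by
    refine (hJ.le_iff.mp J.le_normalizer).resolve_left fun h ↦ hJ.1 (top_le_iff.mp ?_)
    rw [← hL, LieSubmodule.top_lie_le_iff_le_normalizer, h]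
  rw [← hnormalizer, LieSubmodule.mem_normalizer]
  intro x
  rw [lie_smul, ← smul_lie]
  exact lie_mem_right R L J (a • x) k hk

section Annihilator

variable {K A L : Type*} [Field K] [CommRing A] [Algebra K A] [LieRing L] [LieAlgebra K L]
  [LieAlgebra A L] [IsScalarTower K A L] {J : LieIdeal K L} {J' : Submodule A L}

theorem isPrime_annihilator_quotient (hJ : IsCoatom J)
    (hJJ' : J'.restrictScalars K = J.toSubmodule) : (Module.annihilator A (L ⧸ J')).IsPrime := by
  have mem_J {k : L} : k ∈ J' ↔ k ∈ J := SetLike.ext_iff.mp hJJ' k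
  have mem_annihilator {a : A} : a ∈ Module.annihilator A (L ⧸ J') ↔ ∀ k, a • k ∈ J := by
    simp only [Module.mem_annihilator, (Submodule.mkQ_surjective J').forall, Submodule.mkQ_apply,
      ← Submodule.Quotient.mk_smul, Submodule.Quotient.mk_eq_zero, mem_J]
  refine Ideal.isPrime_iff.mpr
    ⟨fun h ↦ hJ.1 ?_, fun {a b} hab ↦ or_iff_not_imp_left.mpr fun ha ↦ ?_⟩
  · rw [Ideal.eq_top_iff_one, mem_annihilator] at h
    exact eq_top_iff.mpr fun k _ ↦ by simpa only [one_smul] using h k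
  · rw [mem_annihilator] at hab ha ⊢
    let N : LieIdeal K L :=
      { J.toSubmodule.comap ((LinearMap.lsmul A L a).restrictScalars K) with
        lie_mem := fun {x k} hk ↦ by
          change a • ⁅x, k⁆ ∈ J
          rw [← lie_smul]
          exact J.lie_mem hk }
    have hN : N = J :=
      (hJ.le_iff.mp fun k hk ↦ show a • k ∈ J from
        mem_J.mp (J'.smul_mem a (mem_J.mpr hk))).resolve_left
      fun h ↦ ha fun k ↦ show k ∈ N from h ▸ LieSubmodule.mem_top k
    exact fun k ↦ hN ▸ (show a • b • k ∈ J from smul_smul a b k ▸ hab k)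

variable (K A) in
theorem finiteDimensional_quotient_annihilator (V : Type*) [AddCommGroup V] [Module K V]
    [Module A V] [IsScalarTower K A V] [FiniteDimensional K V] :
    FiniteDimensional K (A ⧸ Module.annihilator A V) := by
  have : ((Module.annihilator A V).restrictScalars K).CoFG :=
    Submodule.CoFG.of_le
      (fun a ha ↦ Module.mem_annihilator.mpr fun v ↦
        LinearMap.congr_fun (LinearMap.mem_ker.mp ha) v)
      (Submodule.CoFG.ker (Algebra.lsmul K K V : A →ₐ[K] Module.End K V).toLinearMap)
  exact .equiv (Submodule.Quotient.restrictScalarsEquiv K (Module.annihilator A V))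

variable (K) in
theorem isMaximal_of_isPrime_of_finiteDimensional {I : Ideal A} (hI : I.IsPrime)
    [FiniteDimensional K (A ⧸ I)] : I.IsMaximal := by
  have := IsArtinianRing.of_finite K (A ⧸ I)
  exact Ideal.Quotient.maximal_of_isField _ (IsArtinianRing.isField_of_isDomain _)

end Annihilator

section SmoothFunctions

open Set Filter

variable {E : Type*} [NormedAddCommGroup E] [NormedSpace ℝ E]
  {H : Type*} [TopologicalSpace H] {I : ModelWithCorners ℝ E H}
  {M : Type*} [TopologicalSpace M] [ChartedSpace H M]

theorem aeval_contMDiffMap_apply (p : Polynomial ℝ) (f : C^∞⟮I, M; 𝓘(ℝ, ℝ), ℝ⟯) (x : M) :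
    Polynomial.aeval f p x = p.eval (f x) := by
  induction p using Polynomial.induction_on' with
  | add p q hp hq => simp only [map_add, ContMDiffMap.coe_add, Pi.add_apply, hp, hq,
      Polynomial.eval_add]
  | monomial n a =>
    rw [Polynomial.aeval_monomial, Polynomial.eval_monomial]
    exact congrArg (a * ·) (map_pow (ContMDiffMap.evalRingHom x) f n)

theorem isUnit_contMDiffMap {f : C^∞⟮I, M; 𝓘(ℝ, ℝ), ℝ⟯} (hf : ∀ x, f x ≠ 0) : IsUnit f :=
  IsUnit.of_mul_eq_one ⟨fun x ↦ (f x)⁻¹, f.contMDiff.inv₀ hf⟩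
    (ContMDiffMap.ext fun x ↦ mul_inv_cancel₀ (hf x))

theorem exists_mem_forall_pos_of_isCompact {J : Ideal C^∞⟮I, M; 𝓘(ℝ, ℝ), ℝ⟯} {K : Set M}
    (hK : IsCompact K) (hJ : ∀ x ∈ K, ∃ f ∈ J, f x ≠ 0) :
    ∃ g ∈ J, (∀ x, 0 ≤ g x) ∧ ∀ x ∈ K, 0 < g x := by
  choose! f hfJ hf using hJ
  obtain ⟨t, htK, hKt⟩ := hK.elim_nhds_subcover (fun x ↦ {y | f x y ≠ 0})
    fun x hx ↦ (f x).contMDiff.continuous.continuousAt.eventually_ne (hf x hx)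
  have hsum (y : M) : (∑ x ∈ t, f x * f x) y = ∑ x ∈ t, f x y * f x y :=
    map_sum (ContMDiffMap.evalRingHom y) _ t
  refine ⟨∑ x ∈ t, f x * f x, sum_mem fun x hx ↦ J.mul_mem_left _ (hfJ x (htK x hx)),
    fun y ↦ ?_, fun y hy ↦ ?_⟩ <;> rw [hsum]
  · exact Finset.sum_nonneg fun x _ ↦ mul_self_nonneg _
  · obtain ⟨x, hxt, hxy⟩ := mem_iUnion₂.mp (hKt hy)
    exact Finset.sum_pos' (fun x _ ↦ mul_self_nonneg _) ⟨x, hxt, mul_self_pos.mpr hxy⟩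

theorem exists_integer_cutoffs (ρ : C^∞⟮I, M; 𝓘(ℝ, ℝ), ℝ⟯) :
    ∃ χ : ℤ → C^∞⟮I, M; 𝓘(ℝ, ℝ), ℝ⟯, LocallyFinite (fun n ↦ {x | χ n x ≠ 0}) ∧
      (∀ {n : ℤ} {x}, |ρ x - n| ≤ 1 / 2 → χ n x = 1) ∧
      ∀ {n : ℤ} {x}, 1 ≤ |ρ x - n| → χ n x = 0 := by
  let β : ContDiffBump (0 : ℝ) := ⟨1 / 2, 1, by norm_num, by norm_num⟩
  have β_eq_zero {y : ℝ} (hy : 1 ≤ |y|) : β y = 0 := β.zero_of_le_dist (by rwa [dist_zero_right])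
  refine ⟨fun n ↦ ⟨fun x ↦ β (ρ x - n), β.contDiff.contMDiff.comp
    (ρ.contMDiff.sub contMDiff_const)⟩, fun m ↦ ?_,
    fun hx ↦ β.one_of_mem_closedBall (mem_closedBall_zero_iff.mpr hx), β_eq_zero⟩
  refine ⟨ρ ⁻¹' Metric.ball (ρ m) 1, ρ.contMDiff.continuous.continuousAt.preimage_mem_nhds
    (Metric.ball_mem_nhds _ one_pos), (Set.finite_Icc ⌊ρ m - 2⌋ ⌈ρ m + 2⌉).subset ?_⟩
  rintro n ⟨x, hx, hxm⟩
  have hn := abs_lt.mp (not_le.mp (mt β_eq_zero hx))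
  have hm := abs_lt.mp (mem_ball_iff_norm.mp hxm)
  exact ⟨Int.floor_le_iff.mpr (by linarith), Int.le_ceil_iff.mpr (by linarith)⟩

variable [FiniteDimensional ℝ E] [IsManifold I ∞ M] [T2Space M] [SigmaCompactSpace M]

variable (I M) in
theorem exists_contMDiffMap_isCompact_sublevel :
    ∃ ρ : C^∞⟮I, M; 𝓘(ℝ, ℝ), ℝ⟯, ∀ c : ℝ, IsCompact (ρ ⁻¹' Iic c) := by
  have := Manifold.locallyCompact_of_finiteDimensional (M := M) I
  let K := CompactExhaustion.choice M
  obtain ⟨ρ, hρ⟩ := exists_contMDiffMap_forall_mem_convex_of_local_const (I := I) (n := ⊤)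
    (t := fun x ↦ Ici (K.find x : ℝ)) (fun x ↦ convex_Ici _) fun m ↦ by
      refine ⟨(K.find m + 1 : ℕ), ?_⟩
      filter_upwards [isOpen_interior.mem_nhds (K.subset_interior_succ _ (K.mem_find m))] with y hy
      exact mem_Ici.mpr (Nat.cast_le.mpr (K.mem_iff_find_le.mp (interior_subset hy)))
  refine ⟨ρ, fun c ↦ (K.isCompact ⌈c⌉₊).of_isClosed_subset
    (isClosed_Iic.preimage ρ.contMDiff.continuous) fun x hx ↦ K.mem_iff_find_le.mpr ?_⟩
  exact Nat.cast_le.mp (((hρ x).trans hx).trans (Nat.le_ceil c))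

theorem exists_forall_mem_apply_eq_zero {J : Ideal C^∞⟮I, M; 𝓘(ℝ, ℝ), ℝ⟯} (hJ : J ≠ ⊤)
    [FiniteDimensional ℝ (C^∞⟮I, M; 𝓘(ℝ, ℝ), ℝ⟯ ⧸ J)] : ∃ m, ∀ f ∈ J, f m = 0 := by
  by_contra! hne
  obtain ⟨ρ, hρ⟩ := exists_contMDiffMap_isCompact_sublevel I M
  let p := minpoly ℝ (Ideal.Quotient.mk J ρ)
  have hp : p ≠ 0 := minpoly.ne_zero (IsIntegral.of_finite ℝ _)
  have hpJ : Polynomial.aeval ρ p ∈ J := by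
    rw [← Ideal.Quotient.eq_zero_iff_mem, ← Ideal.Quotient.mkₐ_eq_mk ℝ,
      ← Polynomial.aeval_algHom_apply]
    exact minpoly.aeval ℝ (Ideal.Quotient.mk J ρ)
  -- The zeros of `p(ρ)` lie in a compact sublevel set of `ρ`; adding a sum of squares of elements
  -- of `J` that is positive there makes the square of `p(ρ)` invertible.
  obtain ⟨c, hc⟩ := p.roots.toFinset.finite_toSet.bddAbove
  obtain ⟨g, hgJ, hg, hg_pos⟩ := exists_mem_forall_pos_of_isCompact (hρ c) fun x _ ↦ hne x
  have hpos (x : M) : 0 < g x + Polynomial.aeval ρ p x * Polynomial.aeval ρ p x := by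
    by_cases hx : Polynomial.aeval ρ p x = 0
    · have hroot : ρ x ∈ p.roots.toFinset := by
        rwa [Multiset.mem_toFinset, Polynomial.mem_roots hp, Polynomial.IsRoot,
          ← aeval_contMDiffMap_apply]
      exact add_pos_of_pos_of_nonneg (hg_pos x (hc hroot)) (mul_self_nonneg _)
    · exact add_pos_of_nonneg_of_pos (hg x) (mul_self_pos.mpr hx)
  exact hJ (J.eq_top_of_isUnit_mem (J.add_mem hgJ (J.mul_mem_left _ hpJ))
    (isUnit_contMDiffMap fun x ↦ (hpos x).ne'))

theorem exists_eq_ker_evalRingHom {J : Ideal C^∞⟮I, M; 𝓘(ℝ, ℝ), ℝ⟯} (hJ : J.IsMaximal)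
    [FiniteDimensional ℝ (C^∞⟮I, M; 𝓘(ℝ, ℝ), ℝ⟯ ⧸ J)] :
    ∃ m, J = RingHom.ker (ContMDiffMap.evalRingHom m) := by
  obtain ⟨m, hm⟩ := exists_forall_mem_apply_eq_zero hJ.ne_top
  exact ⟨m, hJ.eq_of_le (RingHom.ker_ne_top _) hm⟩

end SmoothFunctions

section LinearAlgebra

open Module

theorem exists_dual_of_span_add_smul_ne_top {K V ι : Type*} [Field K] [AddCommGroup V] [Module K V]
    {s : V} {w : ι → V} {a : ι → K} (hs : Submodule.span K (insert s (Set.range w)) = ⊤)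
    (ha : Submodule.span K (Set.range fun i ↦ w i + a i • s) ≠ ⊤) :
    ∃ ξ : Dual K V, ∀ i, a i = -ξ (w i) := by
  obtain ⟨φ, hφ, hφ_span⟩ := Submodule.exists_le_ker_of_lt_top _ ha.lt_top
  have hφw (i : ι) : φ (w i) = -(a i * φ s) := by
    rw [← add_eq_zero_iff_eq_neg, ← smul_eq_mul, ← map_smul, ← map_add]
    exact hφ_span (Submodule.subset_span ⟨i, rfl⟩)
  have hφs : φ s ≠ 0 := fun h ↦ hφ <| LinearMap.ker_eq_top.mp <| top_le_iff.mp <| hs.ge.trans <|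
    Submodule.span_le.mpr <| Set.insert_subset h <| Set.range_subset_iff.mpr fun i ↦ by
      rw [SetLike.mem_coe, LinearMap.mem_ker, hφw, h, mul_zero, neg_zero]
  refine ⟨(φ s)⁻¹ • φ, fun i ↦ ?_⟩
  rw [LinearMap.smul_apply, hφw, smul_neg, neg_neg, smul_eq_mul, mul_comm,
    mul_inv_cancel_right₀ hφs]

end LinearAlgebra

section SmoothFamilies

open Module

variable {E : Type*} [NormedAddCommGroup E] [NormedSpace ℝ E]
  {H : Type*} [TopologicalSpace H] {I : ModelWithCorners ℝ E H}
  {M : Type*} [TopologicalSpace M] [ChartedSpace H M]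
  {W F : Type*} [NormedAddCommGroup W] [NormedSpace ℝ W] [NormedAddCommGroup F] [NormedSpace ℝ F]

theorem exists_contMDiffOn_rightInverse [CompleteSpace F] {n : WithTop ℕ∞} {T : M → W →L[ℝ] F}
    {U : Set M} (hU : IsOpen U) (hT : ContMDiffOn I 𝓘(ℝ, W →L[ℝ] F) n T U) {m : M} (hm : m ∈ U)
    {B₀ : F →L[ℝ] W} (hB₀ : T m ∘L B₀ = .id ℝ F) :
    ∃ V ∈ 𝓝 m, ∃ B : M → F →L[ℝ] W, ContMDiffOn I 𝓘(ℝ, F →L[ℝ] W) n B V ∧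
      ∀ x ∈ V, T x ∘L B x = .id ℝ F := by
  have hTB : ContMDiffOn I 𝓘(ℝ, F →L[ℝ] F) n (fun x ↦ T x ∘L B₀) U :=
    hT.clm_comp contMDiffOn_const
  refine ⟨U ∩ (fun x ↦ T x ∘L B₀) ⁻¹' {S | IsUnit S}, ?_,
    fun x ↦ B₀ ∘L Ring.inverse (T x ∘L B₀), ?_, fun x hx ↦ Ring.mul_inverse_cancel _ hx.2⟩
  · refine (hTB.continuousOn.isOpen_inter_preimage hU Units.isOpen).mem_nhds ⟨hm, ?_⟩
    exact show IsUnit (T m ∘L B₀) from hB₀.symm ▸ isUnit_one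
  · refine contMDiffOn_const.clm_comp fun x hx ↦ ?_
    obtain ⟨u, hu⟩ := hx.2
    have hinv : ContDiffAt ℝ n Ring.inverse (T x ∘L B₀) :=
      (show (u : F →L[ℝ] F) = T x ∘L B₀ from hu) ▸ contDiffAt_ringInverse ℝ u
    exact hinv.contMDiffAt.comp_contMDiffWithinAt x ((hTB x hx.1).mono Set.inter_subset_left)

theorem exists_dimH_biUnion_range_le [FiniteDimensional ℝ E] [FiniteDimensional ℝ W]
    {f : M → W →L[ℝ] F} {m : M} (hf : ContMDiffAt I 𝓘(ℝ, W →L[ℝ] F) 1 f m) :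
    ∃ V ∈ 𝓝 m, dimH (⋃ x ∈ V, Set.range (f x)) ≤ (finrank ℝ E + finrank ℝ W : ℕ) := by
  let ψ := extChartAt I m
  obtain ⟨u, hu, -, hfu⟩ :=
    (contMDiffAt_iff.mp hf).2.contDiffOn le_rfl (by simp)
  obtain ⟨ε, hε, hball⟩ :=
    Metric.mem_nhdsWithin_iff.mp (nhdsWithin_mono _ (Set.subset_insert _ _) hu)
  let D : Set (E × W) := (Metric.ball (ψ m) ε ∩ Set.range I) ×ˢ Set.univ
  have hD : Convex ℝ D := ((convex_ball _ _).inter I.convex_range).prod convex_univ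
  let Φ : E × W → F := fun p ↦ f (ψ.symm p.1) p.2
  have hΦ : ContDiffOn ℝ 1 Φ D :=
    (hfu.comp contDiff_fst.contDiffOn fun p hp ↦ hball hp.1).clm_apply contDiff_snd.contDiffOn
  refine ⟨ψ.source ∩ ψ ⁻¹' Metric.ball (ψ m) ε, Filter.inter_mem (extChartAt_source_mem_nhds m)
    ((continuousAt_extChartAt m).preimage_mem_nhds (Metric.ball_mem_nhds _ hε)), ?_⟩
  calc dimH (⋃ x ∈ ψ.source ∩ ψ ⁻¹' Metric.ball (ψ m) ε, Set.range (f x)) ≤ dimH (Φ '' D) := by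
        refine dimH_mono (Set.iUnion₂_subset fun x hx ↦ Set.range_subset_iff.mpr fun w ↦
          ⟨(ψ x, w), ⟨⟨hx.2, extChartAt_target_subset_range m (ψ.map_source hx.1)⟩, trivial⟩, ?_⟩)
        simp only [Φ, ψ.left_inv hx.1]
    _ ≤ dimH D := hΦ.dimH_image_le hD subset_rfl
    _ ≤ dimH (Set.univ : Set (E × W)) := dimH_mono (Set.subset_univ D)
    _ = (finrank ℝ E + finrank ℝ W : ℕ) := by rw [Real.dimH_univ_eq_finrank, finrank_prod]

end SmoothFamilies

section SectionModules

open Module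

variable {M L : Type*} [AddCommGroup L] [Module ℝ L]
  {V : M → Type*} [∀ x, AddCommGroup (V x)] [∀ x, Module ℝ (V x)] {ev : ∀ x, L →ₗ[ℝ] V x}

/-- The sections `t i` generate the fibre at `x`. -/
def SpansAt (ev : ∀ x, L →ₗ[ℝ] V x) {ι : Type*} (t : ι → L) (x : M) : Prop :=
  Submodule.span ℝ (Set.range fun i ↦ ev x (t i)) = ⊤

theorem SpansAt.of_forall_mem_span {ι κ : Type*} {t : ι → L} {s : κ → L} {x : M}
    (ht : SpansAt ev t x)
    (hts : ∀ i, ev x (t i) ∈ Submodule.span ℝ (Set.range fun j ↦ ev x (s j))) : SpansAt ev s x :=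
  top_le_iff.mp (ht.ge.trans (Submodule.span_le.mpr (Set.range_subset_iff.mpr hts)))

theorem SpansAt.of_comp {ι κ : Type*} {s : κ → L} {e : ι → κ} {x : M}
    (hs : SpansAt ev (s ∘ e) x) : SpansAt ev s x :=
  hs.of_forall_mem_span fun i ↦ Submodule.subset_span ⟨e i, rfl⟩

variable {E : Type*} [NormedAddCommGroup E] [NormedSpace ℝ E]
  {H : Type*} [TopologicalSpace H] {I : ModelWithCorners ℝ E H}
  {F : Type*} [NormedAddCommGroup F] [NormedSpace ℝ F]
  [TopologicalSpace M] [ChartedSpace H M] [Module C^∞⟮I, M; 𝓘(ℝ, ℝ), ℝ⟯ L]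

variable (I F) in
/-- The `C^∞(M)`-module `L` is the module of smooth sections of a vector bundle over `M` with
fibres `V x` and model fibre `F`, where `ev x k` is the value at `x` of the section `k`. Neither
the total space nor its topology is part of the data: the smooth structure is recorded by local
coordinates `φ` on the fibres in which all the sections are smooth, together with the property
that whatever agrees with a section near every point is a section. -/
structure IsSectionModule (ev : ∀ x, L →ₗ[ℝ] V x) : Prop where
  surjective : ∀ x, Function.Surjective (ev x)
  eq_zero : ∀ k, (∀ x, ev x k = 0) → k = 0
  ev_smul : ∀ (f : C^∞⟮I, M; 𝓘(ℝ, ℝ), ℝ⟯) k x, ev x (f • k) = f x • ev x k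
  exists_glue : ∀ v : ∀ x, V x, (∀ m, ∃ k, ∀ᶠ x in 𝓝 m, ev x k = v x) → ∃ k, ∀ x, ev x k = v x
  exists_coord : ∀ m, ∃ U : Set M, IsOpen U ∧ m ∈ U ∧ ∃ φ : ∀ x, V x ≃ₗ[ℝ] F,
    ∀ k, ContMDiffOn I 𝓘(ℝ, F) ∞ (fun x ↦ φ x (ev x k)) U

namespace IsSectionModule

theorem ext (h : IsSectionModule I F ev) {k k' : L} (hk : ∀ x, ev x k = ev x k') : k = k' :=
  sub_eq_zero.mp (h.eq_zero _ fun x ↦ by rw [map_sub, hk x, sub_self])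

theorem exists_local_coeff [FiniteDimensional ℝ F] (h : IsSectionModule I F ev) {ι : Type*}
    [Fintype ι] {t : ι → L} {m : M} (ht : SpansAt ev t m) :
    ∃ U ∈ 𝓝 m, ∀ k, ∃ f : M → ι → ℝ, ContMDiffOn I 𝓘(ℝ, ι → ℝ) ∞ f U ∧
      ∀ x ∈ U, ev x k = ∑ i, f x i • ev x (t i) ∧ (ev x k = 0 → f x = 0) := by
  obtain ⟨U, hU, hmU, φ, hφ⟩ := h.exists_coord m
  let T (x : M) : (ι → ℝ) →L[ℝ] F :=
    ∑ i, (ContinuousLinearMap.proj (R := ℝ) (φ := fun _ : ι ↦ ℝ) i).smulRight (φ x (ev x (t i)))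
  have T_apply (x : M) (c : ι → ℝ) : T x c = φ x (∑ i, c i • ev x (t i)) := by
    simp only [T, FunLike.coe_sum, Finset.sum_apply, ContinuousLinearMap.smulRight_apply,
      ContinuousLinearMap.proj_apply, map_sum, map_smul]
  have hT : ContMDiffOn I 𝓘(ℝ, (ι → ℝ) →L[ℝ] F) ∞ T U := fun x hx ↦
    ContMDiffWithinAt.sum fun i _ ↦ (ContinuousLinearMap.smulRightL ℝ (ι → ℝ) F
      (ContinuousLinearMap.proj i)).contMDiff.contMDiffAt.comp_contMDiffWithinAt x (hφ (t i) x hx)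
  have hT_surj : Function.Surjective (T m) := fun w ↦ by
    obtain ⟨c, hc⟩ := (Submodule.mem_span_range_iff_exists_fun ℝ).mp
      (ht ▸ Submodule.mem_top : (φ m).symm w ∈ Submodule.span ℝ (Set.range fun i ↦ ev m (t i)))
    exact ⟨c, by rw [T_apply, hc, LinearEquiv.apply_symm_apply]⟩
  obtain ⟨B₀, hB₀⟩ := LinearMap.exists_rightInverse_of_surjective (T m : (ι → ℝ) →ₗ[ℝ] F)
    (LinearMap.range_eq_top.mpr hT_surj)
  obtain ⟨W, hW, B, hB, hTB⟩ := exists_contMDiffOn_rightInverse hU hT hmU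
    (B₀ := LinearMap.toContinuousLinearMap B₀) (ContinuousLinearMap.coe_injective hB₀)
  refine ⟨W ∩ U, Filter.inter_mem hW (hU.mem_nhds hmU), fun k ↦
    ⟨fun x ↦ B x (φ x (ev x k)), (hB.mono Set.inter_subset_left).clm_apply
      ((hφ k).mono Set.inter_subset_right), fun x hx ↦ ⟨(φ x).injective ?_, fun h0 ↦ ?_⟩⟩⟩
  · rw [← T_apply]
    exact (DFunLike.congr_fun (hTB x hx.1) (φ x (ev x k))).symm
  · simp only [h0, map_zero]

theorem eventually_spansAt [FiniteDimensional ℝ F] (h : IsSectionModule I F ev) {ι : Type*}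
    [Finite ι] {t : ι → L} {m : M} (ht : SpansAt ev t m) : ∀ᶠ x in 𝓝 m, SpansAt ev t x := by
  cases nonempty_fintype ι
  obtain ⟨U, hU, hcoeff⟩ := h.exists_local_coeff ht
  filter_upwards [hU] with x hx
  refine Submodule.eq_top_iff'.mpr fun w ↦ ?_
  obtain ⟨k, rfl⟩ := h.surjective x w
  obtain ⟨f, -, hf⟩ := hcoeff k
  exact (Submodule.mem_span_range_iff_exists_fun ℝ).mpr ⟨f x, (hf x hx).1.symm⟩

theorem exists_ev_eq_finsum (h : IsSectionModule I F ev) {ι : Type*} {t : ι → L}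
    (ht : LocallyFinite fun i ↦ {x | ev x (t i) ≠ 0}) : ∃ k, ∀ x, ev x k = ∑ᶠ i, ev x (t i) := by
  refine h.exists_glue _ fun m ↦ ?_
  obtain ⟨U, hU, hfin⟩ := ht m
  refine ⟨∑ i ∈ hfin.toFinset, t i, ?_⟩
  filter_upwards [hU] with x hx
  rw [map_sum, finsum_eq_sum_of_support_subset]
  exact fun i hi ↦ hfin.mem_toFinset.mpr ⟨x, hi, hx⟩

theorem exists_spansAt [FiniteDimensional ℝ F] (h : IsSectionModule I F ev) (m : M) :
    ∃ (n : ℕ) (t : Fin n → L), SpansAt ev t m := by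
  obtain ⟨U, -, -, φ, -⟩ := h.exists_coord m
  let b := (finBasis ℝ F).map (φ m).symm
  choose t ht using fun i ↦ h.surjective m (b i)
  exact ⟨_, t, by simpa only [SpansAt, ht] using b.span_eq⟩

theorem exists_spansAt_of_isCompact [FiniteDimensional ℝ F] (h : IsSectionModule I F ev)
    {A : Set M} (hA : IsCompact A) :
    ∃ (n : ℕ) (t : Fin n → L), ∀ x ∈ A, SpansAt ev t x := by
  refine hA.induction_on ⟨0, Fin.elim0, by simp⟩ ?_ ?_ fun m _ ↦ ?_
  · rintro A A' hAA' ⟨n, t, ht⟩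
    exact ⟨n, t, fun x hx ↦ ht x (hAA' hx)⟩
  · rintro A A' ⟨n, t, ht⟩ ⟨n', t', ht'⟩
    refine ⟨n + n', Fin.append t t', fun x hx ↦ hx.elim (fun hx ↦ ?_) fun hx ↦ ?_⟩
    · exact .of_comp (e := Fin.castAdd n') (by simpa [Function.comp_def] using ht x hx)
    · exact .of_comp (e := Fin.natAdd n) (by simpa [Function.comp_def] using ht' x hx)
  · obtain ⟨n, t, ht⟩ := h.exists_spansAt m
    exact ⟨_, mem_nhdsWithin_of_mem_nhds (h.eventually_spansAt ht), n, t, fun _ hx ↦ hx⟩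

variable [FiniteDimensional ℝ E]

theorem exists_dimH_le [FiniteDimensional ℝ F] (h : IsSectionModule I F ev) {n : ℕ}
    (t : Fin n → L) (s : L) (m : M) :
    ∃ U ∈ 𝓝 m, ∃ B : Set (Fin n → ℝ), dimH B ≤ (finrank ℝ E + finrank ℝ F : ℕ) ∧
      ∀ a ∉ B, ∀ x ∈ U, SpansAt ev (Fin.cons s t : Fin (n + 1) → L) x →
        SpansAt ev (fun i ↦ t i + a i • s) x := by
  obtain ⟨U, hU, hmU, φ, hφ⟩ := h.exists_coord m
  -- The coefficients `a` for which spanning fails are `fun i ↦ -ξ (t i)` for some `ξ` in the dual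
  -- of the fibre, and `(x, ξ)` varies in a space of dimension `dim E + dim F`.
  let single (i : Fin n) : F →L[ℝ] (F →L[ℝ] ℝ) →L[ℝ] (Fin n → ℝ) :=
    (ContinuousLinearMap.smulRightL ℝ (F →L[ℝ] ℝ) (Fin n → ℝ)).flip (Pi.single i (-1)) ∘L
      ContinuousLinearMap.apply ℝ ℝ (E := F)
  let evDual (x : M) := ∑ i, single i (φ x (ev x (t i)))
  have hevDual : ContMDiffAt I 𝓘(ℝ, (F →L[ℝ] ℝ) →L[ℝ] (Fin n → ℝ)) 1 evDual m :=
    ContMDiffAt.sum fun i _ ↦ by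
      have hi := ((hφ (t i)).contMDiffAt (hU.mem_nhds hmU)).of_le (ENat.LEInfty.out (m := 1))
      exact (ContinuousLinearMap.contMDiff (F := (F →L[ℝ] ℝ) →L[ℝ] (Fin n → ℝ))
        (single i)).contMDiffAt.comp m hi
  obtain ⟨W, hW, hdim⟩ := exists_dimH_biUnion_range_le hevDual
  refine ⟨U ∩ W, Filter.inter_mem (hU.mem_nhds hmU) hW, _, hdim.trans_eq ?_, ?_⟩
  · rw [← (LinearMap.toContinuousLinearMap (𝕜 := ℝ) (E := F) (F' := ℝ)).finrank_eq,
      Subspace.dual_finrank_eq]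
  intro a ha x hx hspan
  by_contra hns
  have hspan' : Submodule.span ℝ (insert (ev x s) (Set.range fun i ↦ ev x (t i))) = ⊤ := by
    rw [← hspan, ← Fin.range_cons]
    exact congrArg (Submodule.span ℝ <| Set.range ·) <| funext fun i ↦ i.cases rfl fun _ ↦ rfl
  obtain ⟨ξ, hξ⟩ := exists_dual_of_span_add_smul_ne_top hspan' (a := a) (by
    simpa only [SpansAt, map_add, map_smul] using hns)
  refine ha (Set.mem_biUnion hx.2 ⟨LinearMap.toContinuousLinearMap (ξ ∘ₗ (φ x).symm), ?_⟩)
  ext i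
  simp [evDual, single, Pi.single_apply, hξ]

theorem exists_spansAt_pred [FiniteDimensional ℝ F] (h : IsSectionModule I F ev) {A : Set M}
    (hA : IsCompact A) {n : ℕ} (hn : finrank ℝ E + finrank ℝ F < n) {t : Fin (n + 1) → L}
    (ht : ∀ x ∈ A, SpansAt ev t x) : ∃ t' : Fin n → L, ∀ x ∈ A, SpansAt ev t' x := by
  obtain ⟨B, hB, hspan⟩ : ∃ B : Set (Fin n → ℝ), dimH B ≤ (finrank ℝ E + finrank ℝ F : ℕ) ∧
      ∀ a ∉ B, ∀ x ∈ A, SpansAt ev t x → SpansAt ev (fun i ↦ t i.succ + a i • t 0) x := by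
    refine hA.induction_on ⟨∅, by simp⟩ ?_ ?_ fun m _ ↦ ?_
    · rintro A A' hAA' ⟨B, hB, hspan⟩
      exact ⟨B, hB, fun a ha x hx ↦ hspan a ha x (hAA' hx)⟩
    · rintro A A' ⟨B, hB, hspan⟩ ⟨B', hB', hspan'⟩
      refine ⟨B ∪ B', (dimH_union B B').trans_le (max_le hB hB'), fun a ha x hx ↦ ?_⟩
      exact hx.elim (hspan a (fun h ↦ ha (.inl h)) x) (hspan' a (fun h ↦ ha (.inr h)) x)
    · obtain ⟨U, hU, B, hB, hspan⟩ := h.exists_dimH_le (Fin.tail t) (t 0) m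
      refine ⟨U, mem_nhdsWithin_of_mem_nhds hU, B, hB, fun a ha x hx htx ↦ hspan a ha x hx ?_⟩
      rwa [Fin.cons_self_tail]
  obtain ⟨a, ha⟩ := (dense_compl_of_dimH_lt_finrank (hB.trans_lt (by
    rw [finrank_fin_fun]
    exact_mod_cast hn))).nonempty
  exact ⟨_, fun x hx ↦ hspan a ha x hx (ht x hx)⟩

theorem exists_spansAt_finrank [FiniteDimensional ℝ F] (h : IsSectionModule I F ev) {A : Set M}
    (hA : IsCompact A) :
    ∃ t : Fin (finrank ℝ E + finrank ℝ F + 1) → L, ∀ x ∈ A, SpansAt ev t x := by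
  set N := finrank ℝ E + finrank ℝ F + 1
  have reduce (j : ℕ) (t : Fin (N + j) → L) (ht : ∀ x ∈ A, SpansAt ev t x) :
      ∃ t' : Fin N → L, ∀ x ∈ A, SpansAt ev t' x := by
    induction j with
    | zero => exact ⟨t, ht⟩
    | succ j ih =>
      obtain ⟨t', ht'⟩ := h.exists_spansAt_pred hA (n := N + j) (by lia) ht
      exact ih t' ht'
  obtain ⟨n, t, ht⟩ := h.exists_spansAt_of_isCompact hA
  refine reduce n (Fin.append 0 t) fun x hx ↦ .of_comp (e := Fin.natAdd N) ?_
  simpa [Function.comp_def] using ht x hx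

variable [IsManifold I ∞ M] [T2Space M] [SigmaCompactSpace M]

theorem exists_forall_spansAt [FiniteDimensional ℝ F] (h : IsSectionModule I F ev) :
    ∃ (ι : Type) (_ : Fintype ι) (t : ι → L), ∀ x, SpansAt ev t x := by
  obtain ⟨ρ, hρ⟩ := exists_contMDiffMap_isCompact_sublevel I M
  choose t ht using fun n : ℤ ↦ h.exists_spansAt_finrank (hρ (n + 1))
  obtain ⟨χ, hfin, χ_eq_one, χ_eq_zero⟩ := exists_integer_cutoffs ρ
  -- The cutoffs with indices of a fixed parity `p.1` have disjoint supports, so that the sum over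
  -- them agrees on each layer with a single term.
  choose T hT using fun p : Bool × Fin _ ↦ h.exists_ev_eq_finsum
    (t := fun j : ℤ ↦ χ (Int.bit p.1 j) • t (Int.bit p.1 j) p.2)
    ((hfin.comp_injective (g := Int.bit p.1) fun j j' hj ↦ by
      simpa only [Int.div2_bit] using congrArg Int.div2 hj).subset fun j x hx h0 ↦
      hx (by rw [h.ev_smul]; exact (congrArg (· • _) h0).trans (zero_smul ℝ _)))
  refine ⟨_, inferInstance, T, fun x ↦ ?_⟩
  let n := round (ρ x)
  have hn : |ρ x - n| ≤ 1 / 2 := abs_sub_round _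
  have T_eq (i) : ev x (T (n.bodd, i)) = ev x (t n i) := by
    rw [hT, finsum_eq_single _ n.div2 fun j hj ↦ ?_]
    · rw [Int.bit_decomp, h.ev_smul, χ_eq_one hn, one_smul]
    · have two_le : 2 ≤ |n - Int.bit n.bodd j| := by
        have := Int.bit_decomp n
        rw [Int.bit_val] at this ⊢
        exact le_abs.mpr (by lia)
      have two_le' : (2 : ℝ) ≤ |(n : ℝ) - (Int.bit n.bodd j : ℤ)| := mod_cast two_le
      have := abs_sub_le (n : ℝ) (ρ x) (Int.bit n.bodd j : ℤ)
      rw [abs_sub_comm (n : ℝ) (ρ x)] at this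
      rw [h.ev_smul, χ_eq_zero (by dsimp only; linarith), zero_smul]
  exact (ht n x (by
    have := (abs_le.mp hn).2
    change ρ x ≤ n + 1
    linarith)).of_forall_mem_span fun i ↦ Submodule.subset_span ⟨_, T_eq i⟩

theorem exists_eq_sum_smul [FiniteDimensional ℝ F]
    (h : IsSectionModule I F ev) {ι : Type*} [Fintype ι] {t : ι → L}
    (ht : ∀ x, SpansAt ev t x) (k : L) :
    ∃ f : ι → C^∞⟮I, M; 𝓘(ℝ, ℝ), ℝ⟯, k = ∑ i, f i • t i ∧
      ∀ x, ev x k = 0 → ∀ i, f i x = 0 := by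
  obtain ⟨g, hg⟩ := exists_contMDiffMap_forall_mem_convex_of_local (I := I) (n := ⊤)
    (t := fun x ↦ {c : ι → ℝ | ev x k = ∑ i, c i • ev x (t i) ∧ (ev x k = 0 → c = 0)})
    (fun x ↦ by
      rintro c ⟨hc, hc0⟩ d ⟨hd, hd0⟩ a b _ _ hab
      refine ⟨?_, fun h0 ↦ by rw [hc0 h0, hd0 h0, smul_zero, smul_zero, add_zero]⟩
      simp only [Pi.add_apply, Pi.smul_apply, add_smul, Finset.sum_add_distrib, smul_assoc,
        ← Finset.smul_sum, ← hc, ← hd]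
      rw [← add_smul, hab, one_smul])
    (fun m ↦ by
      obtain ⟨U, hU, hcoeff⟩ := h.exists_local_coeff (ht m)
      exact ⟨U, hU, hcoeff k⟩)
  refine ⟨fun i ↦ ⟨fun x ↦ g x i, contMDiff_pi_space.mp g.contMDiff i⟩, h.ext fun x ↦ ?_,
    fun x h0 i ↦ congrFun ((hg x).2 h0) i⟩
  rw [map_sum, (hg x).1]
  exact Finset.sum_congr rfl fun i _ ↦ (h.ev_smul ⟨fun x ↦ g x i, _⟩ (t i) x).symm

end IsSectionModule

end SectionModules

section SectionLieAlgebras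

variable {M L : Type*} [LieRing L] [LieAlgebra ℝ L]
  {V : M → Type*} [∀ x, LieRing (V x)] [∀ x, LieAlgebra ℝ (V x)] {ev : ∀ x, L →ₗ⁅ℝ⁆ V x}

theorem SpansAt.lie {ι : Type*} {t : ι → L} {x : M}
    (hV : ⁅(⊤ : LieIdeal ℝ (V x)), (⊤ : LieIdeal ℝ (V x))⁆ = ⊤)
    (ht : SpansAt (fun x ↦ (ev x : L →ₗ[ℝ] V x)) t x) :
    SpansAt (fun x ↦ (ev x : L →ₗ[ℝ] V x)) (fun p : ι × ι ↦ ⁅t p.1, t p.2⁆) x := by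
  have hbracket := LieSubmodule.lieIdeal_oper_eq_linear_span' (R := ℝ) (I := (⊤ : LieIdeal ℝ (V x)))
    (N := (⊤ : LieIdeal ℝ (V x)))
  rw [hV, LieSubmodule.top_toSubmodule] at hbracket
  refine top_le_iff.mp (hbracket.le.trans (Submodule.span_le.mpr ?_))
  rintro _ ⟨y, -, z, -, rfl⟩
  have hyz := Submodule.apply_mem_map₂
    (LinearMap.mk₂ ℝ (fun y z : V x ↦ ⁅y, z⁆) add_lie smul_lie lie_add fun c y z ↦ lie_smul c y z)
    (ht.ge (Submodule.mem_top (x := y))) (ht.ge (Submodule.mem_top (x := z)))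
  rw [Submodule.map₂_span_span] at hyz
  refine Submodule.span_mono ?_ hyz
  rintro _ ⟨_, ⟨i, rfl⟩, _, ⟨j, rfl⟩, rfl⟩
  exact ⟨(i, j), (ev x).map_lie (t i) (t j)⟩

namespace IsSectionModule

variable {E : Type*} [NormedAddCommGroup E] [NormedSpace ℝ E] [FiniteDimensional ℝ E]
  {H : Type*} [TopologicalSpace H] {I : ModelWithCorners ℝ E H}
  {F : Type*} [NormedAddCommGroup F] [NormedSpace ℝ F] [FiniteDimensional ℝ F]
  [TopologicalSpace M] [ChartedSpace H M] [IsManifold I ∞ M] [T2Space M] [SigmaCompactSpace M]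
  [LieAlgebra C^∞⟮I, M; 𝓘(ℝ, ℝ), ℝ⟯ L]

theorem lie_top_eq_top (h : IsSectionModule I F fun x ↦ (ev x : L →ₗ[ℝ] V x))
    (hV : ∀ x, ⁅(⊤ : LieIdeal ℝ (V x)), (⊤ : LieIdeal ℝ (V x))⁆ = ⊤) :
    ⁅(⊤ : LieIdeal ℝ L), (⊤ : LieIdeal ℝ L)⁆ = ⊤ := by
  obtain ⟨ι, _, t, ht⟩ := h.exists_forall_spansAt
  refine eq_top_iff.mpr fun k _ ↦ ?_
  obtain ⟨f, rfl, -⟩ := h.exists_eq_sum_smul (fun x ↦ (ht x).lie (hV x)) k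
  refine sum_mem fun p _ ↦ ?_
  rw [← smul_lie]
  exact LieSubmodule.lie_mem_lie (LieSubmodule.mem_top _) (LieSubmodule.mem_top _)

theorem exists_ker_le_of_isCoatom [IsScalarTower ℝ C^∞⟮I, M; 𝓘(ℝ, ℝ), ℝ⟯ L]
    (h : IsSectionModule I F fun x ↦ (ev x : L →ₗ[ℝ] V x))
    (hV : ∀ x, ⁅(⊤ : LieIdeal ℝ (V x)), (⊤ : LieIdeal ℝ (V x))⁆ = ⊤) {J : LieIdeal ℝ L}
    (hJ : IsCoatom J) (hfin : J.toSubmodule.CoFG) : ∃ m, (ev m).ker ≤ J := by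
  let A := C^∞⟮I, M; 𝓘(ℝ, ℝ), ℝ⟯
  let J' : Submodule A L :=
    { J.toSubmodule with
      smul_mem' := fun f _ hk ↦ smul_mem_of_isCoatom (h.lie_top_eq_top hV) hJ f hk }
  have hprime := isPrime_annihilator_quotient hJ (J' := J') rfl
  have : FiniteDimensional ℝ (L ⧸ J') :=
    have : FiniteDimensional ℝ (L ⧸ J'.restrictScalars ℝ) := hfin
    .equiv (Submodule.Quotient.restrictScalarsEquiv ℝ J')
  have := finiteDimensional_quotient_annihilator ℝ A (L ⧸ J')
  obtain ⟨m, hm⟩ :=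
    exists_eq_ker_evalRingHom (isMaximal_of_isPrime_of_finiteDimensional ℝ hprime)
  obtain ⟨ι, _, t, ht⟩ := h.exists_forall_spansAt
  refine ⟨m, fun k hk ↦ ?_⟩
  obtain ⟨f, rfl, hf⟩ := h.exists_eq_sum_smul ht k
  refine sum_mem fun i _ ↦ ?_
  have hfi : f i ∈ Module.annihilator A (L ⧸ J') := hm.ge (hf m hk i)
  exact (Submodule.Quotient.mk_eq_zero J').mp
    (Module.mem_annihilator.mp hfi (Submodule.Quotient.mk (t i)))

theorem isMaximalFiniteCodimensional_iff_exists_comap [IsScalarTower ℝ C^∞⟮I, M; 𝓘(ℝ, ℝ), ℝ⟯ L]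
    (h : IsSectionModule I F fun x ↦ (ev x : L →ₗ[ℝ] V x))
    (hV : ∀ x, ⁅(⊤ : LieIdeal ℝ (V x)), (⊤ : LieIdeal ℝ (V x))⁆ = ⊤) {J : LieIdeal ℝ L} :
    IsMaximalFiniteCodimensional J ↔
      ∃ (m : M) (g₀ : LieIdeal ℝ (V m)), IsCoatom g₀ ∧ J = LieIdeal.comap (ev m) g₀ := by
  have (m : M) : FiniteDimensional ℝ (V m) :=
    let ⟨_, _, _, φ, _⟩ := h.exists_coord m
    .equiv (φ m).symm
  constructor
  · intro hJ
    obtain ⟨m, hm⟩ := h.exists_ker_le_of_isCoatom hV (isMaximalFiniteCodimensional_iff.mp hJ).1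
      (isMaximalFiniteCodimensional_iff.mp hJ).2
    have hcomap := comap_map_of_surjective (h.surjective m) hm
    rw [← hcomap, isMaximalFiniteCodimensional_comap_iff (h.surjective m)] at hJ
    exact ⟨m, _, hJ, hcomap.symm⟩
  · rintro ⟨m, g₀, hg₀, rfl⟩
    exact (isMaximalFiniteCodimensional_comap_iff (h.surjective m)).mpr hg₀

end IsSectionModule

end SectionLieAlgebras

section RelatedVectorFields

variable {𝕜 : Type*} [NontriviallyNormedField 𝕜]
  {E : Type*} [NormedAddCommGroup E] [NormedSpace 𝕜 E]
  {E' : Type*} [NormedAddCommGroup E'] [NormedSpace 𝕜 E']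

theorem lieBracketWithin_apply_of_related {φ : E → E'} {s : Set E} {s' : Set E'} {x : E}
    {n : WithTop ℕ∞} (hφ : ContDiffWithinAt 𝕜 n φ s x) (hn : minSmoothness 𝕜 2 ≤ n)
    (hs : UniqueDiffOn 𝕜 s) (hx' : x ∈ closure (interior s)) (hx : x ∈ s)
    (hmaps : Set.MapsTo φ s s') {V W : E → E} {V' W' : E' → E'}
    (hV : DifferentiableWithinAt 𝕜 V s x) (hW : DifferentiableWithinAt 𝕜 W s x)
    (hV' : DifferentiableWithinAt 𝕜 V' s' (φ x)) (hW' : DifferentiableWithinAt 𝕜 W' s' (φ x))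
    (hVV' : ∀ᶠ y in 𝓝[s] x, fderivWithin 𝕜 φ s y (V y) = V' (φ y))
    (hWW' : ∀ᶠ y in 𝓝[s] x, fderivWithin 𝕜 φ s y (W y) = W' (φ y)) :
    fderivWithin 𝕜 φ s x (lieBracketWithin 𝕜 V W s x) = lieBracketWithin 𝕜 V' W' s' (φ x) := by
  have hφx : DifferentiableWithinAt 𝕜 φ s x :=
    (hφ.of_le (le_minSmoothness.trans hn)).differentiableWithinAt two_ne_zero
  have fderiv_along {X : E → E} {X' : E' → E'} (hX' : DifferentiableWithinAt 𝕜 X' s' (φ x))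
      (hXX' : ∀ᶠ y in 𝓝[s] x, fderivWithin 𝕜 φ s y (X y) = X' (φ y)) (v : E) :
      fderivWithin 𝕜 (fun y ↦ fderivWithin 𝕜 φ s y (X y)) s x v =
        fderivWithin 𝕜 X' s' (φ x) (fderivWithin 𝕜 φ s x v) := by
    rw [Filter.EventuallyEq.fderivWithin_eq_of_mem (f₁ := fun y ↦ fderivWithin 𝕜 φ s y (X y))
      (f := X' ∘ φ) hXX' hx, fderivWithin_comp x hX' hφx hmaps (hs x hx)]
    rfl
  rw [fderivWithin_apply_lieBracket hφ hn hs hx' hx hW hV, fderiv_along hW' hWW',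
    fderiv_along hV' hVV', hVV'.self_of_nhdsWithin hx, hWW'.self_of_nhdsWithin hx]
  rfl

variable {H : Type*} [TopologicalSpace H] {I : ModelWithCorners 𝕜 E H}
  {N : Type*} [TopologicalSpace N] [ChartedSpace H N]
  {H' : Type*} [TopologicalSpace H'] {I' : ModelWithCorners 𝕜 E' H'}
  {N' : Type*} [TopologicalSpace N'] [ChartedSpace H' N']

theorem mpullbackWithin_extChartAt_symm_extChartAt [IsManifold I 1 N] {x y : N}
    (hy : y ∈ (extChartAt I x).source) (V : ∀ y : N, TangentSpace I y) :
    mpullbackWithin 𝓘(𝕜, E) I (extChartAt I x).symm V (Set.range I) (extChartAt I x y) =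
      mfderiv I 𝓘(𝕜, E) (extChartAt I x) y (V y) := by
  refine (isInvertible_mfderivWithin_extChartAt_symm
    ((extChartAt I x).map_source hy)).inverse_apply_eq.mpr ?_
  rw [(extChartAt I x).left_inv hy]
  exact (DFunLike.congr_fun (mfderivWithin_extChartAt_symm_comp_mfderiv_extChartAt' hy) (V y)).symm

theorem mpullbackWithin_extChartAt_symm_of_related [IsManifold I 1 N] [IsManifold I' 1 N']
    {j : N → N'} {x : N} {V : ∀ y : N, TangentSpace I y} {V' : ∀ y : N', TangentSpace I' y}
    (hj : ContMDiffAt I I' 1 j x) (hVV' : ∀ᶠ y in 𝓝 x, mfderiv I I' j y (V y) = V' (j y)) :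
    ∀ᶠ z in 𝓝[Set.range I] extChartAt I x x,
      fderivWithin 𝕜 (writtenInExtChartAt I I' x j) (Set.range I) z
        (mpullbackWithin 𝓘(𝕜, E) I (extChartAt I x).symm V (Set.range I) z) =
      mpullbackWithin 𝓘(𝕜, E') I' (extChartAt I' (j x)).symm V' (Set.range I')
        (writtenInExtChartAt I I' x j z) := by
  rw [← map_extChartAt_nhds, Filter.eventually_map]
  filter_upwards [extChartAt_source_mem_nhds (I := I) x,
    hj.continuousAt.preimage_mem_nhds (extChartAt_source_mem_nhds (I := I') (j x)),
    (contMDiffAt_iff_contMDiffAt_nhds (by simp)).mp hj, hVV'] with y hy hjy hj_y hVV'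
  have hφy := (extChartAt I x).map_source hy
  have hrange : UniqueMDiffWithinAt 𝓘(𝕜, E) (Set.range I) (extChartAt I x y) :=
    I.uniqueMDiffOn _ (extChartAt_target_subset_range x hφy)
  have hφ_symm := mdifferentiableWithinAt_extChartAt_symm hφy
  have hj_y' : MDifferentiableAt I I' j y := hj_y.mdifferentiableAt one_ne_zero
  have hψ : MDifferentiableAt I' 𝓘(𝕜, E') (extChartAt I' (j x)) (j y) :=
    mdifferentiableAt_extChartAt (by rwa [← extChartAt_source I'])
  have hleft := (extChartAt I x).left_inv hy
  have hleft' : (j ∘ (extChartAt I x).symm) (extChartAt I x y) = j y := congrArg j hleft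
  have hchain : mfderivWithin 𝓘(𝕜, E) 𝓘(𝕜, E') (writtenInExtChartAt I I' x j) (Set.range I)
      (extChartAt I x y) = (mfderiv I' 𝓘(𝕜, E') (extChartAt I' (j x)) (j y)).comp
        ((mfderiv I I' j y).comp
          (mfderivWithin 𝓘(𝕜, E) I (extChartAt I x).symm (Set.range I) (extChartAt I x y))) := by
    rw [writtenInExtChartAt, mfderiv_comp_mfderivWithin_of_eq hψ ?_ hrange hleft',
      mfderiv_comp_mfderivWithin_of_eq hj_y' hφ_symm hrange hleft]
    exact MDifferentiableAt.comp_mdifferentiableWithinAt_of_eq _ hj_y' hφ_symm hleft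
  have hinv := DFunLike.congr_fun (mfderivWithin_extChartAt_symm_comp_mfderiv_extChartAt' hy) (V y)
  have hwritten : writtenInExtChartAt I I' x j (extChartAt I x y) = extChartAt I' (j x) (j y) :=
    congrArg _ hleft'
  rw [← mfderivWithin_eq_fderivWithin, mpullbackWithin_extChartAt_symm_extChartAt hy, hwritten,
    mpullbackWithin_extChartAt_symm_extChartAt hjy, ← hVV', hchain]
  exact congrArg (fun v ↦ mfderiv I' 𝓘(𝕜, E') (extChartAt I' (j x)) (j y) (mfderiv I I' j y v)) hinv

theorem mlieBracket_eq_lieBracketWithin [IsManifold I 1 N]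
    (V W : ∀ y : N, TangentSpace I y) (x : N) :
    mlieBracket I V W x = lieBracketWithin 𝕜
      (mpullbackWithin 𝓘(𝕜, E) I (extChartAt I x).symm V (Set.range I))
      (mpullbackWithin 𝓘(𝕜, E) I (extChartAt I x).symm W (Set.range I))
      (Set.range I) (extChartAt I x x) := by
  rw [← mlieBracketWithin_univ, mlieBracketWithin_apply, mfderiv_extChartAt_self,
    Set.preimage_univ, Set.univ_inter]
  exact DFunLike.congr_fun ContinuousLinearMap.inverse_id _

theorem mlieBracket_apply_of_related [CompleteSpace E] [CompleteSpace E']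
    [IsManifold I 2 N] [IsManifold I' 2 N'] {j : N → N'} {x : N} {n : WithTop ℕ∞}
    (hj : ContMDiffAt I I' n j x) (hn : minSmoothness 𝕜 2 ≤ n)
    {V W : ∀ y : N, TangentSpace I y} {V' W' : ∀ y : N', TangentSpace I' y}
    (hV : MDifferentiableAt I I.tangent (fun y ↦ (V y : TangentBundle I N)) x)
    (hW : MDifferentiableAt I I.tangent (fun y ↦ (W y : TangentBundle I N)) x)
    (hV' : MDifferentiableAt I' I'.tangent (fun y ↦ (V' y : TangentBundle I' N')) (j x))
    (hW' : MDifferentiableAt I' I'.tangent (fun y ↦ (W' y : TangentBundle I' N')) (j x))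
    (hVV' : ∀ᶠ y in 𝓝 x, mfderiv I I' j y (V y) = V' (j y))
    (hWW' : ∀ᶠ y in 𝓝 x, mfderiv I I' j y (W y) = W' (j y)) :
    mfderiv I I' j x (mlieBracket I V W x) = mlieBracket I' V' W' (j x) := by
  have : IsManifold I 1 N := .of_le one_le_two
  have : IsManifold I' 1 N' := .of_le one_le_two
  have hj1 : ContMDiffAt I I' 1 j x := hj.of_le (one_le_two.trans (le_minSmoothness.trans hn))
  have hx : writtenInExtChartAt I I' x j (extChartAt I x x) = extChartAt I' (j x) (j x) := by
    simp only [writtenInExtChartAt, Function.comp_apply, extChartAt_to_inv]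
  rw [(hj1.mdifferentiableAt one_ne_zero).mfderiv, mlieBracket_eq_lieBracketWithin,
    mlieBracket_eq_lieBracketWithin, ← hx]
  rw [← mdifferentiableWithinAt_univ] at hV hW hV' hW'
  refine lieBracketWithin_apply_of_related (s' := Set.range I') (contMDiffAt_iff.mp hj).2 hn
    I.uniqueDiffOn
    (I.range_subset_closure_interior (Set.mem_range_self _)) (Set.mem_range_self _)
    (fun _ _ ↦ Set.mem_range_self _) ?_ ?_ ?_ ?_
    (mpullbackWithin_extChartAt_symm_of_related hj1 hVV')
    (mpullbackWithin_extChartAt_symm_of_related hj1 hWW')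
  · simpa using hV.differentiableWithinAt_mpullbackWithin_vectorField
  · simpa using hW.differentiableWithinAt_mpullbackWithin_vectorField
  · simpa [hx] using hV'.differentiableWithinAt_mpullbackWithin_vectorField
  · simpa [hx] using hW'.differentiableWithinAt_mpullbackWithin_vectorField

end RelatedVectorFields

section Derivatives

variable {𝕜 : Type*} [NontriviallyNormedField 𝕜]
  {E : Type*} [NormedAddCommGroup E] [NormedSpace 𝕜 E]
  {H : Type*} [TopologicalSpace H] {I : ModelWithCorners 𝕜 E H}
  {N : Type*} [TopologicalSpace N] [ChartedSpace H N]
  {E' : Type*} [NormedAddCommGroup E'] [NormedSpace 𝕜 E']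
  {H' : Type*} [TopologicalSpace H'] {I' : ModelWithCorners 𝕜 E' H'}
  {N' : Type*} [TopologicalSpace N'] [ChartedSpace H' N']
  {E'' : Type*} [NormedAddCommGroup E''] [NormedSpace 𝕜 E'']
  {H'' : Type*} [TopologicalSpace H''] {I'' : ModelWithCorners 𝕜 E'' H''}
  {N'' : Type*} [TopologicalSpace N''] [ChartedSpace H'' N'']
  {E₃ : Type*} [NormedAddCommGroup E₃] [NormedSpace 𝕜 E₃]
  {H₃ : Type*} [TopologicalSpace H₃] {I₃ : ModelWithCorners 𝕜 E₃ H₃}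
  {N₃ : Type*} [TopologicalSpace N₃] [ChartedSpace H₃ N₃]

theorem contMDiffAt_mfderiv_apply_section
    [IsManifold I 1 N] [IsManifold I' 1 N'] [IsManifold I'' 1 N''] {m n : WithTop ℕ∞} {x₀ : N}
    {f : N → N' → N''} {g : N → N'} {v : ∀ x, TangentSpace I' (g x)}
    (hf : ContMDiffAt (I.prod I') I'' n (Function.uncurry f) (x₀, g x₀)) (hmn : m + 1 ≤ n)
    (hv : ContMDiffAt I I'.tangent m (fun x ↦ (⟨g x, v x⟩ : TangentBundle I' N')) x₀) :
    ContMDiffAt I I''.tangent m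
      (fun x ↦ (⟨f x (g x), mfderiv I' I'' (f x) (g x) (v x)⟩ : TangentBundle I'' N'')) x₀ := by
  have hg : ContMDiffAt I I' m g x₀ := (Bundle.contMDiffAt_totalSpace.mp hv).1
  have hfg : ContMDiffAt I I'' m (fun x ↦ f x (g x)) x₀ :=
    (hf.of_le (le_self_add.trans hmn)).comp x₀ (contMDiffAt_id.prodMk hg)
  exact ContMDiffAt.clm_apply_of_inCoordinates (E₁ := TangentSpace I') (E₂ := TangentSpace I'')
    (ϕ := fun x ↦ mfderiv I' I'' (f x) (g x)) (hf.mfderiv f g hg hmn) hv hfg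

theorem contMDiffAt_of_contMDiffAt_tangentSpace [IsManifold I' 1 N'] {n : WithTop ℕ∞} {x₀ : N}
    {b : N'} {v : N → E'}
    (hv : ContMDiffAt I I'.tangent n (fun x ↦ (⟨b, v x⟩ : TangentBundle I' N')) x₀) :
    ContMDiffAt I 𝓘(𝕜, E') n v x₀ :=
  (Bundle.contMDiffAt_totalSpace.mp hv).2.congr_of_eventuallyEq <|
    .of_forall fun _ ↦ (tangentCoordChange_self (I := I') (mem_extChartAt_source b)).symm

theorem mfderiv_comp_prodMk_apply {f : N' × N'' → N₃} {a : N → N'} {b : N → N''} {x : N}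
    (hf : MDifferentiableAt (I'.prod I'') I₃ f (a x, b x)) (ha : MDifferentiableAt I I' a x)
    (hb : MDifferentiableAt I I'' b x) (v : TangentSpace I x) :
    mfderiv I I₃ (fun y ↦ f (a y, b y)) x v =
      mfderiv I' I₃ (fun z ↦ f (z, b x)) (a x) (mfderiv I I' a x v) +
        mfderiv I'' I₃ (fun z ↦ f (a x, z)) (b x) (mfderiv I I'' b x v) := by
  refine (mfderiv_comp_apply x hf (ha.prodMk hb) v).trans ?_
  rw [mfderiv_prodMk ha hb]
  exact mfderiv_prod_eq_add_apply hf

variable {n : WithTop ℕ∞} {G : Type*} [TopologicalSpace G] [ChartedSpace H G] [Group G]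

theorem mfderiv_inv_one [LieGroup I n G] (hn : n ≠ 0) (h : GroupLieAlgebra I G) :
    (mfderiv I I (fun x : G ↦ x⁻¹) 1 h : E) = -h := by
  have hmul : MDifferentiableAt (I.prod I) I (fun p : G × G ↦ p.1 * p.2) (1, 1⁻¹) :=
    (contMDiff_mul I n _).mdifferentiableAt hn
  have hsum : (mfderiv I I (fun x : G ↦ x * x⁻¹) 1 h : E) =
      mfderiv I I (fun x : G ↦ x * 1⁻¹) 1 (mfderiv I I id 1 h) +
        mfderiv I I (fun x : G ↦ 1 * x) 1⁻¹ (mfderiv I I (fun x ↦ x⁻¹) 1 h) :=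
    mfderiv_comp_prodMk_apply hmul mdifferentiableAt_id
      ((contMDiff_inv I n 1).mdifferentiableAt hn) h
  rw [funext mul_inv_cancel, inv_one, funext mul_one, funext one_mul] at hsum
  erw [mfderiv_const, mfderiv_id] at hsum
  exact eq_neg_of_add_eq_zero_right hsum.symm

end Derivatives

section LocalSections

variable {EM : Type*} [NormedAddCommGroup EM] [NormedSpace ℝ EM]
  {HM : Type*} [TopologicalSpace HM] {IM : ModelWithCorners ℝ EM HM}
  {EG : Type*} [NormedAddCommGroup EG] [NormedSpace ℝ EG]
  {HG : Type*} [TopologicalSpace HG] {IG : ModelWithCorners ℝ EG HG}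
  {EP : Type*} [NormedAddCommGroup EP] [NormedSpace ℝ EP]
  {HP : Type*} [TopologicalSpace HP] {IP : ModelWithCorners ℝ EP HP}
  {M : Type*} [TopologicalSpace M] [ChartedSpace HM M]
  {G : Type*} [TopologicalSpace G] [ChartedSpace HG G] [Group G]
  {P : Type*} [TopologicalSpace P] [ChartedSpace HP P] [MulAction Gᵐᵒᵖ P]
  {π : P → M} {U : Set M} {s : M → P} {q : P → G}

variable (IM IG IP) in
/-- A smooth section `s` of the principal bundle `π` over the open set `U`, together with the
smooth coordinate `q` on `π ⁻¹ U` with values in the structure group for which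
`v = s (π v) <• q v`. -/
structure IsLocalSection (π : P → M) (U : Set M) (s : M → P) (q : P → G) : Prop where
  isOpen : IsOpen U
  contMDiffOn : ContMDiffOn IM IP ∞ s U
  contMDiffOn_coord : ContMDiffOn IP IG ∞ q (π ⁻¹' U)
  proj_apply : ∀ x ∈ U, π (s x) = x
  act_coord : ∀ v, π v ∈ U → s (π v) <• q v = v
  coord_act : ∀ v, π v ∈ U → ∀ g, q (v <• g) = q v * g

theorem IsLocalSection.coord_apply (h : IsLocalSection IM IG IP π U s q) {x : M} (hx : x ∈ U) :
    q (s x) = 1 := by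
  have hsx : π (s x) ∈ U := by rwa [h.proj_apply x hx]
  have hq := congrArg q (h.act_coord (s x) hsx)
  rwa [h.proj_apply x hx, h.coord_act _ hsx, mul_eq_left] at hq

theorem IsLocalSection.isOpen_preimage (h : IsLocalSection IM IG IP π U s q)
    (hP : IsPrincipalBundle IM IG IP G π) : IsOpen (π ⁻¹' U) :=
  h.isOpen.preimage hP.contMDiff_proj.continuous

namespace IsPrincipalBundle

theorem proj_act (hP : IsPrincipalBundle IM IG IP G π) (u : P) (g : G) : π (u <• g) = π u := by
  obtain ⟨U, e, -, hu, hsource, -, -, -, hproj, hact⟩ := hP.exists_trivialization (π u)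
  have hu : u ∈ e.source := hsource ▸ hu
  rw [← hproj _ (hact u hu g).1, (hact u hu g).2, hproj u hu]

theorem exists_act_eq (hP : IsPrincipalBundle IM IG IP G π) {u v : P} (huv : π u = π v) :
    ∃ g : G, u <• g = v := by
  obtain ⟨U, e, -, hu, hsource, -, -, -, hproj, hact⟩ := hP.exists_trivialization (π u)
  have hv : v ∈ e.source := hsource ▸ (huv ▸ hu : π v ∈ U)
  have hu : u ∈ e.source := hsource ▸ hu
  refine ⟨(e u).2⁻¹ * (e v).2, e.injOn (hact u hu _).1 hv ?_⟩
  rw [(hact u hu _).2, mul_inv_cancel_left, hproj u hu, huv, ← hproj v hv]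

theorem exists_isLocalSection [LieGroup IG ∞ G] (hP : IsPrincipalBundle IM IG IP G π) (u : P) :
    ∃ (U : Set M) (s : M → P) (q : P → G),
      IsLocalSection IM IG IP π U s q ∧ π u ∈ U ∧ s (π u) = u := by
  obtain ⟨U, e, hU, hu, hsource, htarget, he, he_symm, hproj, hact⟩ :=
    hP.exists_trivialization (π u)
  have mem_source {v : P} (hv : π v ∈ U) : v ∈ e.source := hsource ▸ hv
  have mem_target {x : M} (hx : x ∈ U) (g : G) : (x, g) ∈ e.target :=
    htarget ▸ Set.mk_mem_prod hx (Set.mem_univ g)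
  have he_apply {v : P} (hv : π v ∈ U) : e v = (π v, (e v).2) :=
    Prod.ext (hproj v (mem_source hv)) rfl
  refine ⟨U, fun x ↦ e.symm (x, (e u).2), fun v ↦ (e u).2⁻¹ * (e v).2,
    ⟨hU, ?_, ?_, ?_, ?_, ?_⟩, hu, ?_⟩
  · exact he_symm.comp (contMDiffOn_id.prodMk contMDiffOn_const) fun x hx ↦ mem_target hx _
  · exact contMDiffOn_const.mul (contMDiff_snd.comp_contMDiffOn (hsource ▸ he))
  · intro x hx
    rw [← hproj _ (e.map_target (mem_target hx _)), e.right_inv (mem_target hx _)]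
  · intro v hv
    have hsv := e.map_target (mem_target hv (e u).2)
    refine e.injOn (hact _ hsv _).1 (mem_source hv) ?_
    rw [(hact _ hsv _).2, e.right_inv (mem_target hv _), mul_inv_cancel_left, ← he_apply hv]
  · intro v hv g
    rw [(hact v (mem_source hv) g).2, mul_assoc]
  · exact (congrArg e.symm (he_apply hu)).symm.trans (e.left_inv (mem_source hu))

theorem contMDiff_orbit (hP : IsPrincipalBundle IM IG IP G π) (u : P) :
    ContMDiff IG IP ∞ (fun g : G ↦ u <• g) :=
  hP.contMDiff_act.comp (contMDiff_const.prodMk contMDiff_id)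

theorem mfderiv_orbit_inv_one [LieGroup IG ∞ G] (hP : IsPrincipalBundle IM IG IP G π)
    (u : P) (h : GroupLieAlgebra IG G) :
    (mfderiv IG IP (fun g : G ↦ u <• g⁻¹) 1 h : EP) = -fundamentalMap IG IP u h := by
  have hinv : MDifferentiableAt IG IG (fun g : G ↦ g⁻¹) 1 :=
    (contMDiff_inv IG ∞ 1).mdifferentiableAt (by simp)
  refine (mfderiv_comp_apply_of_eq (x := (1 : G)) (y := 1)
    ((hP.contMDiff_orbit u 1).mdifferentiableAt (by simp)) hinv inv_one h).trans ?_
  rw [mfderiv_inv_one (n := ∞) (by simp)]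
  exact map_neg (fundamentalMap IG IP u) h

theorem mfderiv_coord_fundamentalMap (hP : IsPrincipalBundle IM IG IP G π)
    (h : IsLocalSection IM IG IP π U s q) {x : M} (hx : x ∈ U) (a : GroupLieAlgebra IG G) :
    (mfderiv IP IG q (s x) (fundamentalMap IG IP (s x) a) : EG) = a := by
  have hsx : π (s x) ∈ U := by rwa [h.proj_apply x hx]
  have hq : MDifferentiableAt IP IG q (s x) :=
    (h.contMDiffOn_coord.contMDiffAt (h.isOpen_preimage hP |>.mem_nhds hsx)).mdifferentiableAt
      (by simp)
  have hcomp : q ∘ (fun g : G ↦ s x <• g) = id := by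
    ext g
    exact (h.coord_act _ hsx g).trans (by rw [h.coord_apply hx, one_mul, id])
  have hderiv := mfderiv_comp_apply_of_eq (x := (1 : G)) hq
    ((hP.contMDiff_orbit (s x) 1).mdifferentiableAt (by simp)) (by simp) a
  rw [hcomp, mfderiv_id] at hderiv
  exact hderiv.symm

theorem fundamentalMap_injective [LieGroup IG ∞ G] (hP : IsPrincipalBundle IM IG IP G π) (u : P) :
    Function.Injective (fundamentalMap IG IP (G := G) u) := by
  obtain ⟨U, s, q, hs, hu, hsu⟩ := hP.exists_isLocalSection u
  intro a b hab
  rw [← hsu] at hab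
  rw [← hP.mfderiv_coord_fundamentalMap hs hu a, hab]
  exact hP.mfderiv_coord_fundamentalMap hs hu b

theorem fundamentalMap_mfderiv_coord (hP : IsPrincipalBundle IM IG IP G π)
    (h : IsLocalSection IM IG IP π U s q) {x : M} (hx : x ∈ U) {v : TangentSpace IP (s x)}
    (hv : mfderiv IP IM π (s x) v = 0) :
    fundamentalMap IG IP (G := G) (s x) (mfderiv IP IG q (s x) v : EG) = v := by
  have hsx : π (s x) ∈ U := by rwa [h.proj_apply x hx]
  have hU : π ⁻¹' U ∈ 𝓝 (s x) := (h.isOpen_preimage hP).mem_nhds hsx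
  have hq : MDifferentiableAt IP IG q (s x) :=
    (h.contMDiffOn_coord.contMDiffAt hU).mdifferentiableAt (by simp)
  have hπ : MDifferentiableAt IP IM π (s x) := (hP.contMDiff_proj _).mdifferentiableAt (by simp)
  have hsπ : ContMDiffAt IM IP ∞ s (π (s x)) :=
    h.contMDiffOn.contMDiffAt (h.isOpen.mem_nhds hsx)
  have hf : MDifferentiableAt (IM.prod IG) IP (fun p : M × G ↦ s p.1 <• p.2) (π (s x), q (s x)) :=
    ((hP.contMDiff_act _).comp _ ((hsπ.comp (π (s x), q (s x)) contMDiffAt_fst).prodMk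
      contMDiffAt_snd)).mdifferentiableAt (by simp)
  have hderiv := mfderiv_comp_prodMk_apply hf hπ hq v
  have hid : (fun w ↦ s (π w) <• q w) =ᶠ[𝓝 (s x)] id :=
    Filter.eventually_of_mem hU h.act_coord
  rw [hv, map_zero, zero_add, hid.mfderiv_eq, mfderiv_id, h.coord_apply hx,
    h.proj_apply x hx] at hderiv
  exact hderiv.symm

end IsPrincipalBundle

end LocalSections

namespace IsPrincipalBundle

variable {EM : Type*} [NormedAddCommGroup EM] [NormedSpace ℝ EM]
  {HM : Type*} [TopologicalSpace HM] {IM : ModelWithCorners ℝ EM HM}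
  {EG : Type*} [NormedAddCommGroup EG] [NormedSpace ℝ EG]
  {HG : Type*} [TopologicalSpace HG] {IG : ModelWithCorners ℝ EG HG}
  {EP : Type*} [NormedAddCommGroup EP] [NormedSpace ℝ EP] [CompleteSpace EP]
  {HP : Type*} [TopologicalSpace HP] {IP : ModelWithCorners ℝ EP HP}
  {M : Type*} [TopologicalSpace M] [ChartedSpace HM M] [IsManifold IM ∞ M]
  {G : Type*} [TopologicalSpace G] [ChartedSpace HG G] [Group G]
  {P : Type*} [TopologicalSpace P] [ChartedSpace HP P] [IsManifold IP ∞ P] [MulAction Gᵐᵒᵖ P]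
  {π : P → M}

/-- An invariant vertical smooth vector field, as an element of `𝒦`. -/
noncomputable def mkKernel (hP : IsPrincipalBundle IM IG IP G π) (X : ∀ u : P, TangentSpace IP u)
    (hX : ContMDiff IP IP.tangent ∞ (fun u ↦ (X u : TangentBundle IP P)))
    (hinv : ∀ (g : G) (u : P), mfderiv IP IP (fun v : P ↦ v <• g) u (X u) = X (u <• g))
    (hvert : ∀ u, mfderiv IP IM π u (X u) = 0) : hP.atiyahKernel :=
  ⟨⟨⟨X, hX⟩, hinv⟩, hvert⟩

theorem atiyahKernel_ext {hP : IsPrincipalBundle IM IG IP G π} {k k' : hP.atiyahKernel}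
    (h : ∀ u, k.1.1 u = k'.1.1 u) : k = k' :=
  Subtype.ext (Subtype.ext (ContMDiffSection.ext h))

theorem mfderiv_act_atiyahKernel (hP : IsPrincipalBundle IM IG IP G π) (k : hP.atiyahKernel)
    (g : G) (u : P) : mfderiv IP IP (fun v : P ↦ v <• g) u (k.1.1 u) = k.1.1 (u <• g) :=
  k.1.2 g u

theorem mfderiv_proj_atiyahKernel (hP : IsPrincipalBundle IM IG IP G π) (k : hP.atiyahKernel)
    (u : P) : mfderiv IP IM π u (k.1.1 u) = 0 :=
  k.2 u

theorem atiyahKernel_apply_eq_of_proj_eq (hP : IsPrincipalBundle IM IG IP G π)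
    {k k' : hP.atiyahKernel} {u v : P} (huv : π u = π v) (h : k.1.1 u = k'.1.1 u) :
    k.1.1 v = k'.1.1 v := by
  obtain ⟨g, rfl⟩ := hP.exists_act_eq huv
  rw [← hP.mfderiv_act_atiyahKernel, ← hP.mfderiv_act_atiyahKernel, h]

theorem exists_atiyahKernel_glue (hP : IsPrincipalBundle IM IG IP G π) (κ : M → hP.atiyahKernel)
    (hκ : ∀ m, ∀ᶠ x in 𝓝 m, ∀ u, π u = x → (κ x).1.1 u = (κ m).1.1 u) :
    ∃ k : hP.atiyahKernel, ∀ u, k.1.1 u = (κ (π u)).1.1 u := by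
  refine ⟨hP.mkKernel (fun u ↦ (κ (π u)).1.1 u) (fun u₀ ↦ ?_) (fun g u ↦ ?_)
    (fun u ↦ hP.mfderiv_proj_atiyahKernel _ u), fun u ↦ rfl⟩
  · refine ((κ (π u₀)).1.1.contMDiff u₀).congr_of_eventuallyEq ?_
    filter_upwards [hP.contMDiff_proj.continuous.continuousAt.eventually (hκ (π u₀))] with u hu
    rw [hu u rfl]
  · rw [hP.mfderiv_act_atiyahKernel, hP.proj_act]

section FunctionAction

variable {hP : IsPrincipalBundle IM IG IP G π}

/-- A smooth function `f` on the base acts on `𝒦` as multiplication by `f ∘ π`. -/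
noncomputable instance : SMul C^∞⟮IM, M; 𝓘(ℝ, ℝ), ℝ⟯ hP.atiyahKernel where
  smul f k := hP.mkKernel (fun u ↦ f (π u) • k.1.1 u)
    ((f.contMDiff.comp hP.contMDiff_proj).smul_section k.1.1.contMDiff)
    (fun g u ↦ by rw [map_smul, hP.mfderiv_act_atiyahKernel, hP.proj_act])
    (fun u ↦ by rw [map_smul, hP.mfderiv_proj_atiyahKernel, smul_zero])

noncomputable instance : Module C^∞⟮IM, M; 𝓘(ℝ, ℝ), ℝ⟯ hP.atiyahKernel where
  one_smul k := atiyahKernel_ext fun u ↦ one_smul ℝ (k.1.1 u)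
  mul_smul f g k := atiyahKernel_ext fun u ↦ mul_smul (f (π u)) (g (π u)) (k.1.1 u)
  smul_zero f := atiyahKernel_ext fun u ↦ smul_zero (f (π u))
  smul_add f k k' := atiyahKernel_ext fun u ↦ smul_add (f (π u)) (k.1.1 u) (k'.1.1 u)
  add_smul f g k := atiyahKernel_ext fun u ↦ add_smul (f (π u)) (g (π u)) (k.1.1 u)
  zero_smul k := atiyahKernel_ext fun u ↦ zero_smul ℝ (k.1.1 u)

instance : IsScalarTower ℝ C^∞⟮IM, M; 𝓘(ℝ, ℝ), ℝ⟯ hP.atiyahKernel where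
  smul_assoc c f k := atiyahKernel_ext fun u ↦ smul_assoc c (f (π u)) (k.1.1 u)

noncomputable instance : LieAlgebra C^∞⟮IM, M; 𝓘(ℝ, ℝ), ℝ⟯ hP.atiyahKernel where
  lie_smul f k k' := atiyahKernel_ext fun u ↦ by
    have hf : MDifferentiableAt IM 𝓘(ℝ, ℝ) f (π u) :=
      (f.contMDiff (π u)).mdifferentiableAt (by simp)
    have hπ : MDifferentiableAt IP IM π u := (hP.contMDiff_proj u).mdifferentiableAt (by simp)
    have hvert : mvfderiv IP (f ∘ π) u (k.1.1 u) = 0 :=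
      (mfderiv_comp_apply u hf hπ _).trans (by rw [hP.mfderiv_proj_atiyahKernel, map_zero]; rfl)
    refine (mlieBracket_smul_right (hf.comp u hπ) (k'.1.1.mdifferentiableAt u)).trans ?_
    rw [hvert, zero_smul, zero_add]
    rfl

end FunctionAction

section Evaluation

variable [LieGroup IG ∞ G] (hP : IsPrincipalBundle IM IG IP G π) (u : P)

theorem evalAt_mem_range_fundamentalMap (k : hP.atiyahKernel) :
    hP.evalAt u k ∈ LinearMap.range (fundamentalMap IG IP (G := G) u) := by
  obtain ⟨U, s, q, hs, hu, hsu⟩ := hP.exists_isLocalSection u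
  rw [← hsu]
  exact ⟨_, hP.fundamentalMap_mfderiv_coord hs hu (hP.mfderiv_proj_atiyahKernel k _)⟩

/-- The identification at `u` of the value of an element of `𝒦` with an element of `𝔤`: the value
`k u` is the fundamental vector of `hP.fibreCoord u k`. -/
noncomputable def fibreCoord : hP.atiyahKernel →ₗ[ℝ] GroupLieAlgebra IG G :=
  (LinearEquiv.ofInjective _ (hP.fundamentalMap_injective u)).symm.toLinearMap ∘ₗ
    (hP.evalAt u).codRestrict _ (hP.evalAt_mem_range_fundamentalMap u)

theorem fundamentalMap_fibreCoord (k : hP.atiyahKernel) :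
    fundamentalMap IG IP u (hP.fibreCoord u k) = k.1.1 u :=
  congrArg Subtype.val ((LinearEquiv.ofInjective _ (hP.fundamentalMap_injective u)).apply_symm_apply
    ((hP.evalAt u).codRestrict _ (hP.evalAt_mem_range_fundamentalMap u) k))

variable {hP u}

theorem fibreCoord_eq_iff {k : hP.atiyahKernel} {h : GroupLieAlgebra IG G} :
    hP.fibreCoord u k = h ↔ k.1.1 u = fundamentalMap IG IP u h := by
  rw [← hP.fundamentalMap_fibreCoord, (hP.fundamentalMap_injective u).eq_iff]

theorem fibreCoord_eq_fibreCoord_iff {k k' : hP.atiyahKernel} :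
    hP.fibreCoord u k = hP.fibreCoord u k' ↔ k.1.1 u = k'.1.1 u := by
  rw [fibreCoord_eq_iff, hP.fundamentalMap_fibreCoord]

variable (hP u)

theorem mfderiv_orbit_inv_mulInvariantVectorField (k : hP.atiyahKernel) (g : G) :
    mfderiv IG IP (fun a : G ↦ u <• a⁻¹) g
      (mulInvariantVectorField (-hP.fibreCoord u k) g) = k.1.1 (u <• g⁻¹) := by
  have horbit (a : G) : MDifferentiableAt IG IP (fun a : G ↦ u <• a⁻¹) a :=
    (((hP.contMDiff_orbit u).comp (contMDiff_inv IG ∞)) a).mdifferentiableAt (by simp)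
  have hcomm : (fun a : G ↦ u <• a⁻¹) ∘ (g * ·) = (· <• g⁻¹) ∘ fun a : G ↦ u <• a⁻¹ := by
    ext a
    simp [mul_smul]
  have hleft := mfderiv_comp_apply_of_eq (x := (1 : G)) (horbit g)
    ((contMDiff_mul_left (I := IG) (n := ∞) (a := g) 1).mdifferentiableAt (by simp)) (mul_one g)
    (-hP.fibreCoord u k)
  have hright := mfderiv_comp_apply_of_eq (x := (1 : G)) (y := u)
    ((hP.contMDiff_right g⁻¹ u).mdifferentiableAt (by simp)) (horbit 1) (by simp)
    (-hP.fibreCoord u k)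
  rw [← hP.mfderiv_act_atiyahKernel, ← hP.fundamentalMap_fibreCoord]
  refine hleft.symm.trans ?_
  rw [hcomm, hright, hP.mfderiv_orbit_inv_one, map_neg (fundamentalMap IG IP u), neg_neg]

theorem fibreCoord_lie [CompleteSpace EG] (k k' : hP.atiyahKernel) :
    hP.fibreCoord u ⁅k, k'⁆ = -⁅hP.fibreCoord u k, hP.fibreCoord u k'⁆ := by
  have : IsManifold IP 2 P := .of_le (n := ∞) (by norm_cast)
  have : IsManifold IG 2 G := .of_le (n := ∞) (by norm_cast)
  rw [fibreCoord_eq_iff]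
  have horbit : ContMDiff IG IP ∞ (fun a : G ↦ u <• a⁻¹) :=
    (hP.contMDiff_orbit u).comp (contMDiff_inv IG ∞)
  have hbracket := mlieBracket_apply_of_related (x := (1 : G)) (horbit 1) ENat.LEInfty.out
    (mdifferentiableAt_mulInvariantVectorField _) (mdifferentiableAt_mulInvariantVectorField _)
    (k.1.1.mdifferentiableAt _) (k'.1.1.mdifferentiableAt _)
    (.of_forall (hP.mfderiv_orbit_inv_mulInvariantVectorField u k))
    (.of_forall (hP.mfderiv_orbit_inv_mulInvariantVectorField u k'))
  rw [← GroupLieAlgebra.bracket_def, lie_neg, neg_lie, neg_neg] at hbracket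
  have base {v : P} (hv : v = u) : (⁅k, k'⁆.1.1 v : EP) = ⁅k, k'⁆.1.1 u := by rw [hv]
  refine (base (v := u <• (1 : G)⁻¹) (by simp)).symm.trans (hbracket.symm.trans ?_)
  exact (hP.mfderiv_orbit_inv_one u _).trans (map_neg (fundamentalMap IG IP u) _).symm

/-- The evaluation at `u` as a morphism of Lie algebras. The sign reflects that fundamental vector
fields bracket like left invariant vector fields on `G` whereas invariant ones bracket like right
invariant vector fields. -/
noncomputable def evLie [CompleteSpace EG] : hP.atiyahKernel →ₗ⁅ℝ⁆ GroupLieAlgebra IG G :=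
  { -hP.fibreCoord u with
    map_lie' := fun {k k'} ↦ by
      change -hP.fibreCoord u ⁅k, k'⁆ = ⁅-hP.fibreCoord u k, -hP.fibreCoord u k'⁆
      rw [hP.fibreCoord_lie, lie_neg, neg_lie] }

theorem comap_evLie [CompleteSpace EG] (g₀ : LieIdeal ℝ (GroupLieAlgebra IG G)) :
    (LieIdeal.comap (hP.evLie u) g₀).toSubmodule = hP.kernelIdeal u g₀ := by
  ext k
  change -hP.fibreCoord u k ∈ g₀ ↔ ∃ h ∈ g₀, fundamentalMap IG IP u h = k.1.1 u
  rw [neg_mem_iff]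
  refine ⟨fun hk ↦ ⟨_, hk, hP.fundamentalMap_fibreCoord u k⟩, fun ⟨h, hh, hk⟩ ↦ ?_⟩
  rwa [fibreCoord_eq_iff.mpr hk.symm]

end Evaluation

end IsPrincipalBundle

section LocalFrames

variable {EM : Type*} [NormedAddCommGroup EM] [NormedSpace ℝ EM]
  {HM : Type*} [TopologicalSpace HM] {IM : ModelWithCorners ℝ EM HM}
  {EG : Type*} [NormedAddCommGroup EG] [NormedSpace ℝ EG]
  {HG : Type*} [TopologicalSpace HG] {IG : ModelWithCorners ℝ EG HG}
  {EP : Type*} [NormedAddCommGroup EP] [NormedSpace ℝ EP]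
  {HP : Type*} [TopologicalSpace HP] {IP : ModelWithCorners ℝ EP HP}
  {M : Type*} [TopologicalSpace M] [ChartedSpace HM M]
  {G : Type*} [TopologicalSpace G] [ChartedSpace HG G] [Group G]
  {P : Type*} [TopologicalSpace P] [ChartedSpace HP P] [MulAction Gᵐᵒᵖ P]
  {π : P → M} {U : Set M} {s : M → P} {q : P → G}

namespace IsPrincipalBundle

theorem exists_atiyahKernel_apply_eq_of_contMDiffOn [FiniteDimensional ℝ EM] [T2Space M]
    [IsManifold IM ∞ M] [CompleteSpace EP] [IsManifold IP ∞ P]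
    (hP : IsPrincipalBundle IM IG IP G π) (hU : IsOpen U) {m : M} (hm : m ∈ U)
    {X : ∀ v : P, TangentSpace IP v}
    (hX : ContMDiffOn IP IP.tangent ∞ (fun v ↦ (X v : TangentBundle IP P)) (π ⁻¹' U))
    (hinv : ∀ v, π v ∈ U → ∀ g : G, mfderiv IP IP (fun v : P ↦ v <• g) v (X v) = X (v <• g))
    (hvert : ∀ v, π v ∈ U → mfderiv IP IM π v (X v) = 0) :
    ∃ k : hP.atiyahKernel, ∀ u, π u = m → k.1.1 u = X u := by
  obtain ⟨f, -, hfU⟩ :=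
    (SmoothBumpFunction.nhds_basis_tsupport (I := IM) m).mem_iff.mp (hU.mem_nhds hm)
  have hf_zero {x : M} (hx : x ∉ U) : f x = 0 := image_eq_zero_of_notMem_tsupport fun h ↦ hx (hfU h)
  refine ⟨hP.mkKernel (fun v ↦ f (π v) • X v) ?_ (fun g v ↦ ?_) (fun v ↦ ?_), fun u hu ↦ ?_⟩
  · exact ContMDiffOn.smul_section_of_tsupport (f.contMDiff.comp hP.contMDiff_proj).contMDiffOn
      (hU.preimage hP.contMDiff_proj.continuous)
      ((tsupport_comp_subset_preimage f hP.contMDiff_proj.continuous).trans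
        (Set.preimage_mono hfU)) hX
  · rw [map_smul, hP.proj_act]
    by_cases hv : π v ∈ U
    · rw [hinv v hv]
    · rw [hf_zero hv, zero_smul, zero_smul]
  · rw [map_smul]
    by_cases hv : π v ∈ U
    · rw [hvert v hv, smul_zero]
    · rw [hf_zero hv, zero_smul]
  · change f (π u) • X u = X u
    rw [hu, f.eq_one, one_smul]

end IsPrincipalBundle

/-- The invariant vertical vector field over `U` whose value along the local section `s` is the
fundamental vector of `a`: by invariance its value at `v = s (π v) <• q v` is the derivative at
`t = 1` of `s (π v) <• t <• q v` in the direction `a`. -/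
noncomputable def gaugeField (IG : ModelWithCorners ℝ EG HG) (IP : ModelWithCorners ℝ EP HP)
    (π : P → M) (s : M → P) (q : P → G) (a : GroupLieAlgebra IG G) (v : P) : TangentSpace IP v :=
  (mfderiv IG IP (fun t : G ↦ s (π v) <• t <• q v) 1 a : EP)

namespace IsLocalSection

theorem contMDiffAt_act_act (h : IsLocalSection IM IG IP π U s q)
    (hP : IsPrincipalBundle IM IG IP G π) {v : P} (hv : π v ∈ U) (t : G) :
    ContMDiffAt (IP.prod IG) IP ∞ (fun p : P × G ↦ s (π p.1) <• p.2 <• q p.1) (v, t) := by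
  have hsπ : ContMDiffAt IP IP ∞ (fun v ↦ s (π v)) v :=
    (h.contMDiffOn.contMDiffAt (h.isOpen.mem_nhds hv)).comp v (hP.contMDiff_proj v)
  have hq : ContMDiffAt IP IG ∞ q v :=
    h.contMDiffOn_coord.contMDiffAt ((h.isOpen_preimage hP).mem_nhds hv)
  have hst : ContMDiffAt (IP.prod IG) IP ∞ (fun p : P × G ↦ s (π p.1) <• p.2) (v, t) :=
    (hP.contMDiff_act _).comp (v, t) ((hsπ.comp (v, t) contMDiffAt_fst).prodMk contMDiffAt_snd)
  exact (hP.contMDiff_act _).comp (v, t) (hst.prodMk (hq.comp (v, t) contMDiffAt_fst))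

theorem mdifferentiableAt_act_act (h : IsLocalSection IM IG IP π U s q)
    (hP : IsPrincipalBundle IM IG IP G π) {v : P} (hv : π v ∈ U) (t : G) :
    MDifferentiableAt IG IP (fun t : G ↦ s (π v) <• t <• q v) t :=
  ((h.contMDiffAt_act_act hP hv t).comp t
    (contMDiffAt_const.prodMk contMDiffAt_id)).mdifferentiableAt (by simp)

theorem act_one_act (h : IsLocalSection IM IG IP π U s q) {v : P} (hv : π v ∈ U) :
    s (π v) <• (1 : G) <• q v = v := by
  simpa using h.act_coord v hv

theorem contMDiffOn_gaugeField [IsManifold IP ∞ P] [LieGroup IG ∞ G]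
    (h : IsLocalSection IM IG IP π U s q)
    (hP : IsPrincipalBundle IM IG IP G π) (a : GroupLieAlgebra IG G) :
    ContMDiffOn IP IP.tangent ∞
      (fun v ↦ (⟨v, gaugeField IG IP π s q a v⟩ : TangentBundle IP P)) (π ⁻¹' U) := by
  intro v hv
  have hfield := contMDiffAt_mfderiv_apply_section (I := IP) (I' := IG) (I'' := IP) (m := ∞)
    (f := fun v t ↦ s (π v) <• t <• q v) (g := fun _ ↦ 1) (v := fun _ ↦ a)
    (h.contMDiffAt_act_act hP hv 1) (by simp) contMDiffAt_const
  refine (hfield.congr_of_eventuallyEq ?_).contMDiffWithinAt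
  filter_upwards [(h.isOpen_preimage hP).mem_nhds hv] with w hw
  exact congrArg (fun x ↦ (⟨x, (gaugeField IG IP π s q a w : EP)⟩ : TangentBundle IP P))
    (h.act_one_act hw).symm

theorem mfderiv_act_gaugeField (h : IsLocalSection IM IG IP π U s q)
    (hP : IsPrincipalBundle IM IG IP G π) (a : GroupLieAlgebra IG G) {v : P} (hv : π v ∈ U)
    (g : G) : mfderiv IP IP (fun v : P ↦ v <• g) v (gaugeField IG IP π s q a v) =
      gaugeField IG IP π s q a (v <• g) := by
  have hact : (fun t : G ↦ s (π (v <• g)) <• t <• q (v <• g)) =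
      (· <• g) ∘ fun t : G ↦ s (π v) <• t <• q v := by
    ext t
    simp [hP.proj_act, h.coord_act v hv, mul_smul]
  have hderiv := mfderiv_comp_apply_of_eq (x := (1 : G))
    ((hP.contMDiff_right g v).mdifferentiableAt (by simp))
    (h.mdifferentiableAt_act_act hP hv 1) (h.act_one_act hv) a
  rw [← hact] at hderiv
  exact hderiv.symm

theorem mfderiv_proj_gaugeField (h : IsLocalSection IM IG IP π U s q)
    (hP : IsPrincipalBundle IM IG IP G π) (a : GroupLieAlgebra IG G) {v : P} (hv : π v ∈ U) :
    mfderiv IP IM π v (gaugeField IG IP π s q a v) = 0 := by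
  have hconst : π ∘ (fun t : G ↦ s (π v) <• t <• q v) = fun _ ↦ π v := by
    ext t
    simp only [Function.comp_apply, hP.proj_act, h.proj_apply _ hv]
  have hderiv := mfderiv_comp_apply_of_eq (x := (1 : G))
    ((hP.contMDiff_proj v).mdifferentiableAt (by simp))
    (h.mdifferentiableAt_act_act hP hv 1) (h.act_one_act hv) a
  rw [hconst, mfderiv_const] at hderiv
  exact hderiv.symm

theorem gaugeField_apply (h : IsLocalSection IM IG IP π U s q) (a : GroupLieAlgebra IG G)
    {x : M} (hx : x ∈ U) : gaugeField IG IP π s q a (s x) = fundamentalMap IG IP (s x) a := by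
  have hcurve : (fun t : G ↦ s (π (s x)) <• t <• q (s x)) = fun t ↦ s x <• t := by
    simp only [h.proj_apply x hx, h.coord_apply hx, MulOpposite.op_one, one_smul]
  exact congrArg (fun φ : G → P ↦ (mfderiv IG IP φ 1 : EG →L[ℝ] EP) a) hcurve

end IsLocalSection

variable [FiniteDimensional ℝ EM] [T2Space M] [IsManifold IM ∞ M]
  [CompleteSpace EP] [IsManifold IP ∞ P] [LieGroup IG ∞ G]

namespace IsPrincipalBundle

theorem fibreCoord_surjective (hP : IsPrincipalBundle IM IG IP G π) (u : P) :
    Function.Surjective (hP.fibreCoord u) := by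
  intro a
  obtain ⟨U, s, q, hs, hu, hsu⟩ := hP.exists_isLocalSection u
  obtain ⟨k, hk⟩ := hP.exists_atiyahKernel_apply_eq_of_contMDiffOn hs.isOpen hu
    (hs.contMDiffOn_gaugeField hP a) (fun v hv ↦ hs.mfderiv_act_gaugeField hP a hv)
    (fun v hv ↦ hs.mfderiv_proj_gaugeField hP a hv)
  refine ⟨k, fibreCoord_eq_iff.mpr ((hk u rfl).trans ?_)⟩
  rw [← hsu]
  exact hs.gaugeField_apply a hu

end IsPrincipalBundle

end LocalFrames

theorem exists_linearEquiv_of_ker_eq {R A B C : Type*} [Ring R] [AddCommGroup A] [Module R A]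
    [AddCommGroup B] [Module R B] [AddCommGroup C] [Module R C] {f : A →ₗ[R] B} {g : A →ₗ[R] C}
    (hf : Function.Surjective f) (hg : Function.Surjective g)
    (hker : LinearMap.ker f = LinearMap.ker g) : ∃ e : B ≃ₗ[R] C, ∀ a, e (f a) = g a := by
  refine ⟨(f.quotKerEquivOfSurjective hf).symm ≪≫ₗ Submodule.quotEquivOfEq _ _ hker ≪≫ₗ
    g.quotKerEquivOfSurjective hg, fun a ↦ ?_⟩
  have ha : (f.quotKerEquivOfSurjective hf).symm (f a) = Submodule.Quotient.mk a :=
    (LinearEquiv.symm_apply_eq _).mpr rfl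
  rw [LinearEquiv.trans_apply, LinearEquiv.trans_apply, ha]
  rfl

namespace IsPrincipalBundle

variable {EM : Type*} [NormedAddCommGroup EM] [NormedSpace ℝ EM]
  {HM : Type*} [TopologicalSpace HM] {IM : ModelWithCorners ℝ EM HM}
  {EG : Type*} [NormedAddCommGroup EG] [NormedSpace ℝ EG]
  {HG : Type*} [TopologicalSpace HG] {IG : ModelWithCorners ℝ EG HG}
  {EP : Type*} [NormedAddCommGroup EP] [NormedSpace ℝ EP] [CompleteSpace EP]
  {HP : Type*} [TopologicalSpace HP] {IP : ModelWithCorners ℝ EP HP}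
  {M : Type*} [TopologicalSpace M] [ChartedSpace HM M] [IsManifold IM ∞ M]
  {G : Type*} [TopologicalSpace G] [ChartedSpace HG G] [Group G] [LieGroup IG ∞ G]
  {P : Type*} [TopologicalSpace P] [ChartedSpace HP P] [IsManifold IP ∞ P] [MulAction Gᵐᵒᵖ P]
  {π : P → M} {U : Set M} {s : M → P} {q : P → G} (hP : IsPrincipalBundle IM IG IP G π)

theorem fibreCoord_eq_mfderiv_coord (h : IsLocalSection IM IG IP π U s q) {x : M} (hx : x ∈ U)
    (k : hP.atiyahKernel) :
    hP.fibreCoord (s x) k = (mfderiv IP IG q (s x) (k.1.1 (s x)) : EG) :=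
  fibreCoord_eq_iff.mpr
    (hP.fundamentalMap_mfderiv_coord h hx (hP.mfderiv_proj_atiyahKernel k _)).symm

theorem contMDiffOn_fibreCoord (h : IsLocalSection IM IG IP π U s q) (k : hP.atiyahKernel) :
    ContMDiffOn (M' := EG) IM 𝓘(ℝ, EG) ∞ (fun x ↦ hP.fibreCoord (s x) k) U := by
  intro x hx
  have hsx : s x ∈ π ⁻¹' U := by rwa [Set.mem_preimage, h.proj_apply x hx]
  have hq : ContMDiffAt IP IG ∞ q (s x) :=
    h.contMDiffOn_coord.contMDiffAt ((h.isOpen_preimage hP).mem_nhds hsx)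
  have hks : ContMDiffAt IM IP.tangent ∞
      (fun y ↦ (⟨s y, k.1.1 (s y)⟩ : TangentBundle IP P)) x :=
    (k.1.1.contMDiff (s x)).comp x (h.contMDiffOn.contMDiffAt (h.isOpen.mem_nhds hx))
  have hqks := contMDiffAt_mfderiv_apply_section (I := IM) (m := ∞) (f := fun _ ↦ q)
    (hq.comp (x, s x) contMDiffAt_snd) (by simp) hks
  refine (contMDiffAt_of_contMDiffAt_tangentSpace (I' := IG) (b := (1 : G))
    (hqks.congr_of_eventuallyEq ?_)).contMDiffWithinAt
  filter_upwards [h.isOpen.mem_nhds hx] with y hy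
  exact congrArg₂ (fun (g : G) (a : EG) ↦ (⟨g, a⟩ : TangentBundle IG G)) (h.coord_apply hy).symm
    (hP.fibreCoord_eq_mfderiv_coord h hy k)

theorem ker_fibreCoord_eq {u v : P} (huv : π u = π v) :
    LinearMap.ker (hP.fibreCoord u) = LinearMap.ker (hP.fibreCoord v) := by
  ext k
  have hmem (w : P) :
      k ∈ LinearMap.ker (hP.fibreCoord w) ↔ k.1.1 w = (0 : hP.atiyahKernel).1.1 w := by
    rw [LinearMap.mem_ker, ← fibreCoord_eq_fibreCoord_iff, map_zero]
  rw [hmem, hmem]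
  exact ⟨hP.atiyahKernel_apply_eq_of_proj_eq huv, hP.atiyahKernel_apply_eq_of_proj_eq huv.symm⟩

variable [FiniteDimensional ℝ EM] [T2Space M] {σ : M → P}

theorem exists_contMDiffOn_evLie [CompleteSpace EG] (hσ : ∀ m, π (σ m) = m) (m : M) :
    ∃ U : Set M, IsOpen U ∧ m ∈ U ∧ ∃ φ : M → GroupLieAlgebra IG G ≃ₗ[ℝ] EG,
      ∀ k, ContMDiffOn IM 𝓘(ℝ, EG) ∞ (fun x ↦ φ x (hP.evLie (σ x) k)) U := by
  obtain ⟨U, s, q, h, hm, -⟩ := hP.exists_isLocalSection (σ m)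
  have hφ (y : M) : ∃ φ : GroupLieAlgebra IG G ≃ₗ[ℝ] EG, y ∈ U → ∀ k,
      φ (hP.evLie (σ y) k) = (-hP.fibreCoord (s y) k : EG) := by
    by_cases hy : y ∈ U
    · obtain ⟨e, he⟩ := exists_linearEquiv_of_ker_eq (hP.fibreCoord_surjective (σ y))
        (hP.fibreCoord_surjective (s y))
        (hP.ker_fibreCoord_eq ((hσ y).trans (h.proj_apply y hy).symm))
      exact ⟨e, fun _ k ↦ (map_neg e _).trans (congrArg Neg.neg (he k))⟩
    · exact ⟨.refl ℝ EG, fun hy' ↦ absurd hy' hy⟩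
  choose φ hφ using hφ
  exact ⟨U, h.isOpen, hσ m ▸ hm, φ, fun k ↦
    (hP.contMDiffOn_fibreCoord h k).neg.congr fun y hy ↦ hφ y hy k⟩

theorem isSectionModule_evLie [CompleteSpace EG] (hσ : ∀ m, π (σ m) = m) :
    IsSectionModule IM EG
      fun m ↦ (hP.evLie (σ m) : hP.atiyahKernel →ₗ[ℝ] GroupLieAlgebra IG G) where
  surjective m := neg_surjective.comp (hP.fibreCoord_surjective (σ m))
  eq_zero k hk := atiyahKernel_ext fun u ↦ hP.atiyahKernel_apply_eq_of_proj_eq (hσ (π u)) <|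
    fibreCoord_eq_fibreCoord_iff.mp ((neg_eq_zero.mp (hk (π u))).trans (map_zero _).symm)
  ev_smul f k m := by
    have hfk : hP.fibreCoord (σ m) (f • k) = f m • hP.fibreCoord (σ m) k := by
      rw [← map_smul, fibreCoord_eq_fibreCoord_iff]
      exact congrArg (fun x ↦ f x • k.1.1 (σ m)) (hσ m)
    exact (congrArg Neg.neg hfk).trans (smul_neg _ _).symm
  exists_glue v hv := by
    choose κ hκ using hv
    obtain ⟨k, hk⟩ := hP.exists_atiyahKernel_glue κ fun m ↦ by
      filter_upwards [hκ m] with x hx u hu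
      refine hP.atiyahKernel_apply_eq_of_proj_eq ((hσ x).trans hu.symm) ?_
      rw [← fibreCoord_eq_fibreCoord_iff, ← neg_inj]
      exact (hκ x).self_of_nhds.trans hx.symm
    refine ⟨k, fun x ↦ (congrArg Neg.neg ?_).trans (hκ x).self_of_nhds⟩
    exact fibreCoord_eq_fibreCoord_iff.mpr (by rw [hk, hσ])
  exists_coord m := hP.exists_contMDiffOn_evLie hσ m

end IsPrincipalBundle

end Atiyah

theorem mainTheorem6_general
    {EM : Type*} [NormedAddCommGroup EM] [NormedSpace ℝ EM] [FiniteDimensional ℝ EM]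
    {HM : Type*} [TopologicalSpace HM] {IM : ModelWithCorners ℝ EM HM}
    {EG : Type*} [NormedAddCommGroup EG] [NormedSpace ℝ EG] [FiniteDimensional ℝ EG]
    {HG : Type*} [TopologicalSpace HG] {IG : ModelWithCorners ℝ EG HG}
    {EP : Type*} [NormedAddCommGroup EP] [NormedSpace ℝ EP] [CompleteSpace EP]
    {HP : Type*} [TopologicalSpace HP] {IP : ModelWithCorners ℝ EP HP}
    {M : Type*} [TopologicalSpace M] [T2Space M] [SigmaCompactSpace M]
    [ChartedSpace HM M] [IsManifold IM ∞ M]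
    {G : Type*} [TopologicalSpace G] [ChartedSpace HG G] [Group G] [LieGroup IG ∞ G]
    {P : Type*} [TopologicalSpace P] [ChartedSpace HP P] [IsManifold IP ∞ P] [MulAction Gᵐᵒᵖ P]
    {π : P → M} (hP : Atiyah.IsPrincipalBundle IM IG IP G π)
    (hG : ⁅(⊤ : LieIdeal ℝ (GroupLieAlgebra IG G)), (⊤ : LieIdeal ℝ (GroupLieAlgebra IG G))⁆ = ⊤)
    {σ : M → P} (hσ : ∀ m, π (σ m) = m) (S : Submodule ℝ hP.atiyahKernel) :
    (∃ J : LieIdeal ℝ hP.atiyahKernel,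
        Atiyah.IsMaximalFiniteCodimensional J ∧ J.toSubmodule = S) ↔
      ∃ (m : M) (g₀ : LieIdeal ℝ (GroupLieAlgebra IG G)),
        IsCoatom g₀ ∧ S = hP.kernelIdeal (σ m) g₀ := by
  simp_rw [(hP.isSectionModule_evLie hσ).isMaximalFiniteCodimensional_iff_exists_comap
    fun _ ↦ hG, ← hP.comap_evLie]
  constructor
  · rintro ⟨_, ⟨m, g₀, hg₀, rfl⟩, rfl⟩
    exact ⟨m, g₀, hg₀, rfl⟩
  · rintro ⟨m, g₀, hg₀, rfl⟩
    exact ⟨_, ⟨m, g₀, hg₀, rfl⟩, rfl⟩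

/-- Let `P → M` be a smooth principal bundle whose structure group `G` is semisimple, i.e. the Lie
algebra `𝔤` of `G` has trivial radical. The points `σ m` of `P` over `m` are an arbitrary choice of
identifications of the fibres of `K = P ×_G 𝔤` with `𝔤`. A subspace `S` of the kernel `𝒦` of the
Atiyah sequence is a maximal finite-codimensional Lie ideal of `𝒦` if and only if it is
`𝒦(m, 𝔤₀)` for some `m` in `M` and some maximal Lie ideal `𝔤₀` of `𝔤`. -/
theorem mainTheorem6
    {EM : Type*} [NormedAddCommGroup EM] [NormedSpace ℝ EM] [FiniteDimensional ℝ EM]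
    {HM : Type*} [TopologicalSpace HM] (IM : ModelWithCorners ℝ EM HM) [IM.Boundaryless]
    {EG : Type*} [NormedAddCommGroup EG] [NormedSpace ℝ EG] [FiniteDimensional ℝ EG]
    {HG : Type*} [TopologicalSpace HG] (IG : ModelWithCorners ℝ EG HG) [IG.Boundaryless]
    {EP : Type*} [NormedAddCommGroup EP] [NormedSpace ℝ EP] [FiniteDimensional ℝ EP]
    {HP : Type*} [TopologicalSpace HP] (IP : ModelWithCorners ℝ EP HP) [IP.Boundaryless]
    {M : Type*} [TopologicalSpace M] [T2Space M] [SecondCountableTopology M]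
    [ChartedSpace HM M] [IsManifold IM ∞ M]
    {G : Type*} [TopologicalSpace G] [T2Space G] [SecondCountableTopology G]
    [ChartedSpace HG G] [Group G] [LieGroup IG ∞ G]
    {P : Type*} [TopologicalSpace P] [T2Space P] [SecondCountableTopology P]
    [ChartedSpace HP P] [IsManifold IP ∞ P] [MulAction Gᵐᵒᵖ P]
    (π : P → M) (hP : Atiyah.IsPrincipalBundle IM IG IP G π)
    [LieAlgebra.HasTrivialRadical ℝ (GroupLieAlgebra IG G)]
    (σ : M → P) (hσ : ∀ m, π (σ m) = m)
    (S : Submodule ℝ hP.atiyahKernel) :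
    (∃ J : LieIdeal ℝ hP.atiyahKernel,
        Atiyah.IsMaximalFiniteCodimensional J ∧ J.toSubmodule = S) ↔
      ∃ (m : M) (g₀ : LieIdeal ℝ (GroupLieAlgebra IG G)),
        IsCoatom g₀ ∧ S = hP.kernelIdeal (σ m) g₀ := by
  have : LocallyCompactSpace M := Manifold.locallyCompact_of_finiteDimensional IM
  have : FiniteDimensional ℝ (GroupLieAlgebra IG G) := inferInstanceAs (FiniteDimensional ℝ EG)
  exact mainTheorem6_general hP (Atiyah.lie_top_eq_top_of_hasTrivialRadical ℝ _) hσ S
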